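/- Let $t,r\in(0,1)$ with $r^2+t^2=1$, and let $\theta_k,\alpha_k,\gamma_k$ $(k\in\mathbb Z)$ be real numbers. Put $$S_k=e^{-i\theta_k}\begin{pmatrix} r e^{-i\alpha_k} & it e^{i\gamma_k}\\ it e^{-i\gamma_k} & r e^{i\alpha_k}\end{pmatrix}.$$ Let $(\varphi_k)_{k\in\mathbb Z}$ be the canonical basis of $l^2(\mathbb Z)$, let $P_j$ be the orthogonal projection onto $\mathrm{span}(\varphi_j,\varphi_{j+1})$, and let $S_j$ act on this span through its matrix in the basis $(\varphi_j,\varphi_{j+1})$. Let $$U=U_oU_e,\qquad U_e=\sum_{k\in\mathbb Z}P_{2k}S_{2k}P_{2k},\qquad U_o=\sum_{k\in\mathbb Z}P_{2k+1}S_{2k+1}P_{2k+1},$$ a unitary operator on $l^2(\mathbb Z)$. Let the sequence $(\gamma_k)$ be arbitrary, and suppose that for some integer $N\ge 1$ and all $k\in\mathbb Z$, $$\theta_{k+N}=\theta_k,\qquad \alpha_k=ak+\pi_k,\quad\text{where } \pi_{k+N}=\pi_k \text{ and } a\in\mathbb R .$$ Then $U$ is purely absolutely continuous: the spectral measure of every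 $\psi\in l^2(\mathbb Z)$ is absolutely continuous with respect to Lebesgue measure on the unit circle. Moreover, with $\mathbb T=\mathbb R/2\pi\mathbb Z$, there is a map $T:\mathbb T\to\mathbb C^{2N\times 2N}$ with unitary values and real-analytic entries such that $U$ is unitarily equivalent to the operator of multiplication by $T$ on $L^2(\mathbb T;\mathbb C^{2N})$, and such that the eigenvalues of $T$ are non-constant, in the sense that every $c\in\mathbb C$ is an eigenvalue of $T(x)$ for at most finitely many $x\in\mathbb T$. -/

import Mathlib

open MeasureTheory
open scoped ENNReal InnerProductSpace

noncomputable section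

namespace Monodromy

/-- The Hilbert space `l²(ℤ)`. -/
abbrev L2Z : Type := lp (fun _ : ℤ => ℂ) 2

instance fact_two_pi_pos : Fact (0 < 2 * Real.pi) := ⟨Real.two_pi_pos⟩

/-- The torus `𝕋 = ℝ / 2πℤ`. -/
abbrev Torus : Type := AddCircle (2 * Real.pi)

/-! ### The building blocks -/

/-- The `2 × 2` matrix
`S = e^{-iθ} [[r e^{-iα}, i t e^{iγ}], [i t e^{-iγ}, r e^{iα}]]`. -/
def scatMatrix (r t θ α γ : ℝ) : Matrix (Fin 2) (Fin 2) ℂ :=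
  Complex.exp (-(Complex.I * θ)) •
    !![(r : ℂ) * Complex.exp (-(Complex.I * α)),
        Complex.I * (t : ℂ) * Complex.exp (Complex.I * γ);
      Complex.I * (t : ℂ) * Complex.exp (-(Complex.I * γ)),
        (r : ℂ) * Complex.exp (Complex.I * α)]

theorem scatMatrix_mem_unitaryGroup {r t : ℝ} (h : r ^ 2 + t ^ 2 = 1) (θ α γ : ℝ) :
    scatMatrix r t θ α γ ∈ Matrix.unitaryGroup (Fin 2) ℂ := by
  have hc : (r : ℂ) ^ 2 + (t : ℂ) ^ 2 = 1 := by exact_mod_cast h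
  have e : ∀ x : ℝ, Complex.exp (Complex.I * x) * Complex.exp (-(Complex.I * x)) = 1 := by
    intro x; rw [← Complex.exp_add]; simp
  have hθ := e θ
  have hα := e α
  have hγ := e γ
  have hI := Complex.I_sq
  rw [Matrix.mem_unitaryGroup_iff, Matrix.star_eq_conjTranspose]
  ext i j
  fin_cases i <;> fin_cases j <;>
    simp [scatMatrix, Matrix.mul_apply, Fin.sum_univ_two, Matrix.conjTranspose_apply,
      ← Complex.exp_conj] <;>
    generalize Complex.exp (Complex.I * θ) = E at * <;>
    generalize Complex.exp (-(Complex.I * θ)) = E' at * <;>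
    generalize Complex.exp (Complex.I * α) = A at * <;>
    generalize Complex.exp (-(Complex.I * α)) = A' at * <;>
    generalize Complex.exp (Complex.I * γ) = G at * <;>
    generalize Complex.exp (-(Complex.I * γ)) = G' at *
  · linear_combination (r ^ 2 * A * A' + t ^ 2 * G * G') * hθ + r ^ 2 * hα + t ^ 2 * hγ + hc
      - E * E' * t ^ 2 * G * G' * hI
  · ring
  · ring
  · linear_combination (r ^ 2 * A * A' + t ^ 2 * G * G') * hθ + r ^ 2 * hα + t ^ 2 * hγ + hc
      - E * E' * t ^ 2 * G * G' * hI

/-- The matrix `scatMatrix` as an element of the unitary group. -/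
def scatUnitary (r t : ℝ) (h : r ^ 2 + t ^ 2 = 1) (θ α γ : ℝ) : Matrix.unitaryGroup (Fin 2) ℂ :=
  ⟨scatMatrix r t θ α γ, scatMatrix_mem_unitaryGroup h θ α γ⟩

/-! ### Block diagonal operators on `l²(ℤ)` -/

/-- The action on sequences of `∑_{j ≡ p mod 2} P_j S_j P_j`, where `P_j` projects onto the span of
`φ_j, φ_{j+1}` and `S_j` acts on this span through its matrix in the basis `(φ_j, φ_{j+1})`. -/
def blockFun (p : ℤ) (S : ℤ → Matrix (Fin 2) (Fin 2) ℂ) (f : ℤ → ℂ) (j : ℤ) : ℂ :=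
  if Even (j - p) then S j 0 0 * f j + S j 0 1 * f (j + 1)
  else S (j - 1) 1 0 * f (j - 1) + S (j - 1) 1 1 * f j

theorem blockFun_even {p : ℤ} {S : ℤ → Matrix (Fin 2) (Fin 2) ℂ} {f : ℤ → ℂ} {j : ℤ}
    (h : Even (j - p)) :
    blockFun p S f j = S j 0 0 * f j + S j 0 1 * f (j + 1) := if_pos h

theorem blockFun_even_succ {p : ℤ} {S : ℤ → Matrix (Fin 2) (Fin 2) ℂ} {f : ℤ → ℂ} {j : ℤ}
    (h : Even (j - p)) :
    blockFun p S f (j + 1) = S j 1 0 * f j + S j 1 1 * f (j + 1) := by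
  have : ¬ Even (j + 1 - p) := by
    rw [show j + 1 - p = (j - p) + 1 by ring]; simpa [Int.even_add_one] using h
  rw [blockFun, if_neg this]; simp

theorem even_or_eq_succ (p j : ℤ) :
    Even (j - p) ∨ ∃ i, Even (i - p) ∧ j = i + 1 := by
  rcases Int.even_or_odd (j - p) with h | h
  · exact Or.inl h
  · refine Or.inr ⟨j - 1, ?_, by ring⟩
    rw [show j - 1 - p = (j - p) - 1 by ring]
    exact h.sub_odd odd_one

theorem blockFun_mul (p : ℤ) (S S' : ℤ → Matrix (Fin 2) (Fin 2) ℂ) (f : ℤ → ℂ) :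
    blockFun p S (blockFun p S' f) = blockFun p (fun j => S j * S' j) f := by
  funext j
  rcases even_or_eq_succ p j with h | ⟨i, h, rfl⟩
  · rw [blockFun_even h, blockFun_even h, blockFun_even h, blockFun_even_succ h]
    simp only [Matrix.mul_apply, Fin.sum_univ_two]; ring
  · rw [blockFun_even_succ h, blockFun_even_succ h, blockFun_even h, blockFun_even_succ h]
    simp only [Matrix.mul_apply, Fin.sum_univ_two]; ring

theorem blockFun_one (p : ℤ) (f : ℤ → ℂ) : blockFun p (fun _ => 1) f = f := by
  funext j
  rcases even_or_eq_succ p j with h | ⟨i, h, rfl⟩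
  · rw [blockFun_even h]; simp
  · rw [blockFun_even_succ h]; simp

theorem unitary_norm_sq (S : Matrix.unitaryGroup (Fin 2) ℂ) (a b : ℂ) :
    ‖S.1 0 0 * a + S.1 0 1 * b‖ ^ 2 + ‖S.1 1 0 * a + S.1 1 1 * b‖ ^ 2 = ‖a‖ ^ 2 + ‖b‖ ^ 2 := by
  have h := Matrix.mem_unitaryGroup_iff'.1 S.2
  rw [Matrix.star_eq_conjTranspose] at h
  have h00 := congrFun (congrFun h 0) 0
  have h01 := congrFun (congrFun h 0) 1
  have h10 := congrFun (congrFun h 1) 0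
  have h11 := congrFun (congrFun h 1) 1
  simp [Matrix.mul_apply, Fin.sum_univ_two, Matrix.conjTranspose_apply] at h00 h01 h10 h11
  have key : ∀ z : ℂ, ((‖z‖ ^ 2 : ℝ) : ℂ) = (starRingEnd ℂ) z * z := by
    intro z; rw [← Complex.normSq_eq_norm_sq, Complex.normSq_eq_conj_mul_self]
  have : (((‖S.1 0 0 * a + S.1 0 1 * b‖ ^ 2 + ‖S.1 1 0 * a + S.1 1 1 * b‖ ^ 2 : ℝ)) : ℂ)
      = ((‖a‖ ^ 2 + ‖b‖ ^ 2 : ℝ) : ℂ) := by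
    rw [Complex.ofReal_add, Complex.ofReal_add, key, key, key, key]
    simp only [map_add, map_mul]
    linear_combination (starRingEnd ℂ) a * a * h00 + (starRingEnd ℂ) a * b * h01
      + (starRingEnd ℂ) b * a * h10 + (starRingEnd ℂ) b * b * h11
  exact_mod_cast this

theorem blockFun_pair (p : ℤ) (S : ℤ → Matrix.unitaryGroup (Fin 2) ℂ) (f : ℤ → ℂ) {j : ℤ}
    (h : Even (j - p)) :
    ‖blockFun p (fun j => (S j).1) f j‖ ^ 2 + ‖blockFun p (fun j => (S j).1) f (j + 1)‖ ^ 2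
      = ‖f j‖ ^ 2 + ‖f (j + 1)‖ ^ 2 := by
  rw [blockFun_even h, blockFun_even_succ h]
  exact unitary_norm_sq (S j) _ _

theorem summable_norm_sq (f : L2Z) : Summable fun j => ‖f j‖ ^ 2 := by
  have := (memℓp_gen_iff (p := 2) (by norm_num)).1 (lp.memℓp f)
  simpa using this

theorem memLp_of_summable {f : ℤ → ℂ} (h : Summable fun j => ‖f j‖ ^ 2) :
    Memℓp f 2 := by
  apply memℓp_gen
  simpa using h

theorem norm_sq_eq (f : L2Z) : ‖f‖ ^ 2 = ∑' j, ‖f j‖ ^ 2 := by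
  have := lp.norm_rpow_eq_tsum (p := 2) (by norm_num) f
  simpa using this

theorem summable_blockFun (p : ℤ) (S : ℤ → Matrix.unitaryGroup (Fin 2) ℂ) {f : ℤ → ℂ}
    (hf : Summable fun j => ‖f j‖ ^ 2) :
    Summable fun j => ‖blockFun p (fun j => (S j).1) f j‖ ^ 2 := by
  have h1 : Summable fun j : ℤ => ‖f (j + 1)‖ ^ 2 :=
    (Equiv.addRight (1 : ℤ)).summable_iff (f := fun j => ‖f j‖ ^ 2) |>.2 hf
  have h2 : Summable fun j : ℤ => ‖f (j - 1)‖ ^ 2 :=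
    (Equiv.subRight (1 : ℤ)).summable_iff (f := fun j => ‖f j‖ ^ 2) |>.2 hf
  refine Summable.of_nonneg_of_le (fun j => by positivity) (fun j => ?_) ((hf.add h1).add h2)
  rcases even_or_eq_succ p j with h | ⟨i, h, rfl⟩
  · have := blockFun_pair p S f h
    nlinarith [sq_nonneg ‖blockFun p (fun j => (S j).1) f (j + 1)‖, sq_nonneg ‖f (j - 1)‖]
  · have := blockFun_pair p S f h
    rw [add_sub_cancel_right]
    nlinarith [sq_nonneg ‖blockFun p (fun j => (S j).1) f i‖, sq_nonneg ‖f (i + 1 + 1)‖]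

theorem tsum_pair (p : ℤ) {g : ℤ → ℝ} (hg : Summable g) :
    ∑' j, g j = ∑' j, if Even (j - p) then g j + g (j + 1) else 0 := by
  have hind : ∀ s : Set ℤ, Summable (s.indicator g) := fun s => hg.indicator s
  have hE := hind {j | Even (j - p)}
  have hO := hind {j | Even (j - p)}ᶜ
  have hO' : Summable fun j : ℤ => ({j | Even (j - p)}ᶜ : Set ℤ).indicator g (j + 1) :=
    (Equiv.addRight (1 : ℤ)).summable_iff
      (f := ({j | Even (j - p)}ᶜ : Set ℤ).indicator g) |>.2 hO
  calc ∑' j, g j = ∑' j, (({j | Even (j - p)} : Set ℤ).indicator g j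
        + ({j | Even (j - p)}ᶜ : Set ℤ).indicator g j) := by
        simp only [Set.indicator_self_add_compl_apply]
    _ = ∑' j, ({j | Even (j - p)} : Set ℤ).indicator g j
        + ∑' j, ({j | Even (j - p)}ᶜ : Set ℤ).indicator g j := hE.tsum_add hO
    _ = ∑' j, ({j | Even (j - p)} : Set ℤ).indicator g j
        + ∑' j, ({j | Even (j - p)}ᶜ : Set ℤ).indicator g (j + 1) := by
        rw [← (Equiv.addRight (1 : ℤ)).tsum_eq (({j | Even (j - p)}ᶜ : Set ℤ).indicator g)]
        rfl
    _ = ∑' j, (({j | Even (j - p)} : Set ℤ).indicator g j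
        + ({j | Even (j - p)}ᶜ : Set ℤ).indicator g (j + 1)) := (hE.tsum_add hO').symm
    _ = _ := by
        refine tsum_congr fun j => ?_
        have hs : Even (j + 1 - p) ↔ ¬ Even (j - p) := by
          rw [show j + 1 - p = (j - p) + 1 by ring, Int.even_add_one]
        by_cases h : Even (j - p) <;> simp [Set.indicator, hs, h]

theorem tsum_blockFun (p : ℤ) (S : ℤ → Matrix.unitaryGroup (Fin 2) ℂ) {f : ℤ → ℂ}
    (hf : Summable fun j => ‖f j‖ ^ 2) :
    ∑' j, ‖blockFun p (fun j => (S j).1) f j‖ ^ 2 = ∑' j, ‖f j‖ ^ 2 := by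
  rw [tsum_pair p (summable_blockFun p S hf), tsum_pair p hf]
  refine tsum_congr fun j => ?_
  split_ifs with h
  · exact blockFun_pair p S f h
  · rfl

/-- The unitary operator `∑_{j ≡ p mod 2} P_j S_j P_j` on `l²(ℤ)`. -/
def blockOp (p : ℤ) (S : ℤ → Matrix.unitaryGroup (Fin 2) ℂ) : L2Z ≃ₗᵢ[ℂ] L2Z where
  toFun f := ⟨blockFun p (fun j => (S j).1) f,
    memLp_of_summable (summable_blockFun p S (summable_norm_sq f))⟩
  invFun f := ⟨blockFun p (fun j => (S j)⁻¹.1) f,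
    memLp_of_summable (summable_blockFun p (fun j => (S j)⁻¹) (summable_norm_sq f))⟩
  map_add' f g := by
    ext j
    simp only [blockFun, lp.coeFn_add, Pi.add_apply]
    split_ifs <;> ring
  map_smul' c f := by
    ext j
    simp only [blockFun, lp.coeFn_smul, Pi.smul_apply, smul_eq_mul, RingHom.id_apply]
    split_ifs <;> ring
  left_inv f := by
    ext j
    change blockFun p (fun j => (S j)⁻¹.1) (blockFun p (fun j => (S j).1) f) j = f j
    rw [blockFun_mul]
    have : (fun j => (S j)⁻¹.1 * (S j).1) = fun _ => (1 : Matrix (Fin 2) (Fin 2) ℂ) := by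
      funext j; exact congrArg Subtype.val (inv_mul_cancel (S j))
    rw [this, blockFun_one]
  right_inv f := by
    ext j
    change blockFun p (fun j => (S j).1) (blockFun p (fun j => (S j)⁻¹.1) f) j = f j
    rw [blockFun_mul]
    have : (fun j => (S j).1 * (S j)⁻¹.1) = fun _ => (1 : Matrix (Fin 2) (Fin 2) ℂ) := by
      funext j; exact congrArg Subtype.val (mul_inv_cancel (S j))
    rw [this, blockFun_one]
  norm_map' f := by
    refine (sq_eq_sq₀ (norm_nonneg _) (norm_nonneg _)).1 ?_
    rw [norm_sq_eq, norm_sq_eq]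
    exact tsum_blockFun p S (summable_norm_sq f)

/-- The monodromy operator `U = U_o U_e` with constant coefficients `r`, `t`, where
`U_e = ∑_k P_{2k} S_{2k} P_{2k}` and `U_o = ∑_k P_{2k+1} S_{2k+1} P_{2k+1}`. In the group of
unitary operators of `l²(ℤ)` the product is composition. -/
def monodromy (r t : ℝ) (h : r ^ 2 + t ^ 2 = 1) (θ α γ : ℤ → ℝ) : L2Z ≃ₗᵢ[ℂ] L2Z :=
  blockOp 1 (fun k => scatUnitary r t h (θ k) (α k) (γ k)) *
    blockOp 0 (fun k => scatUnitary r t h (θ k) (α k) (γ k))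

/-! ### Spectral notions -/

/-- `μ` is the spectral measure of the unitary operator `U` at the vector `ψ`, transported to `𝕋`
by `x ↦ e^{ix}`: the finite Borel measure (unique, by its Fourier coefficients) with
`∫ e^{inx} dμ(x) = ⟨ψ, Uⁿ ψ⟩` for all `n ∈ ℤ`. -/
def IsSpectralMeasure {H : Type*} [NormedAddCommGroup H] [InnerProductSpace ℂ H]
    (U : H ≃ₗᵢ[ℂ] H) (ψ : H) (μ : Measure Torus) : Prop :=
  IsFiniteMeasure μ ∧ ∀ n : ℤ, ∫ x, fourier n x ∂μ = ⟪ψ, (U ^ n) ψ⟫_ℂ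

/-- `U` is purely absolutely continuous: the spectral measure of every vector is absolutely
continuous with respect to Lebesgue measure. -/
def IsPurelyAC {H : Type*} [NormedAddCommGroup H] [InnerProductSpace ℂ H]
    (U : H ≃ₗᵢ[ℂ] H) : Prop :=
  ∀ ψ : H, ∃ μ : Measure Torus, IsSpectralMeasure U ψ μ ∧ μ ≪ volume

/-- `U` is unitarily equivalent to the operator of multiplication by the matrix-valued function `T`
on `L²(𝕋; ℂᵐ)`. -/
def IsUnitarilyEquivalentToMul {H : Type*} [NormedAddCommGroup H] [InnerProductSpace ℂ H]
    (U : H ≃ₗᵢ[ℂ] H) {m : ℕ} (T : Torus → Matrix (Fin m) (Fin m) ℂ) : Prop :=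
  ∃ W : H ≃ₗᵢ[ℂ] Lp (EuclideanSpace ℂ (Fin m)) 2 (volume : Measure Torus),
    ∀ ψ : H, (W (U ψ) : Torus → EuclideanSpace ℂ (Fin m)) =ᵐ[volume]
      fun x => Matrix.toEuclideanLin (T x) (W ψ x)

end Monodromy

end

noncomputable section

namespace Monodromy

/-! Diagonal phases remove both `γ` and the linear part of `α`; the price is the constant `a / 2`
added to every `θ k`. The gauged coefficients have period `N`, but the splitting into even and odd
blocks has period 2, so the even period `m = 2 * N` is used. The Bloch transform then turns each of
the two factors into multiplication by an analytic unitary symbol (`blochTransform_blockOp`), and `T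
x` is the product of the two symbols.

The eigenvalues of `T x` are controlled by a discriminant. An eigenvector with eigenvalue `z`
extends to a solution of `U_o U_e ψ = z ψ` with `ψ (j + m) = e^{-ix} ψ j`. Since `t ≠ 0`, solutions
are propagated by 2 × 2 transfer matrices, so `e^{-ix}` is an eigenvalue of the transfer matrix over
one period. In the gauge `γ = 0` the off-diagonal entries of each block agree and this matrix has
determinant 1, whence `2 cos x = tr (transfer S z m)` (`trace_transfer_of_hasEigenvalue`). For fixed
`z` at most two `x` satisfy this, so the eigenvalues are non-constant.

The same identity gives absolute continuity without perturbation theory of eigenvalues. The trace at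
`z = e^{iy}` is differentiable in `y`, hence maps a null set of `y` to a null set, whose preimage
under `2 cos` is null. So for almost every `x` the spectrum of `T x` misses a given null set
(`ae_not_hasEigenvalue`). The spectral measure of `ψ` is an integral over `x` of spectral measures
of the matrices `T x`, so it vanishes on null sets (`isPurelyAC_of_mul`). -/

/-! ### Gauge transformations -/

/-- The diagonal unitary operator with phases `e^{i d_j}`. -/
def phaseOp (d : ℤ → ℝ) : L2Z ≃ₗᵢ[ℂ] L2Z where
  toFun f := ⟨fun j => Complex.exp (Complex.I * d j) * f j,
    memLp_of_summable (by simpa [mul_comm Complex.I, Complex.norm_exp_ofReal_mul_I]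
      using summable_norm_sq f)⟩
  invFun f := ⟨fun j => Complex.exp (-(Complex.I * d j)) * f j,
    memLp_of_summable (by simpa [Complex.norm_exp] using summable_norm_sq f)⟩
  map_add' f g := by
    ext j
    simp only [lp.coeFn_add, Pi.add_apply, mul_add]
  map_smul' c f := by
    ext j
    simp only [lp.coeFn_smul, Pi.smul_apply, smul_eq_mul, RingHom.id_apply]
    ring
  left_inv f := by
    ext j
    change Complex.exp (-(Complex.I * d j)) * (Complex.exp (Complex.I * d j) * f j) = f j
    rw [← mul_assoc, ← Complex.exp_add]; simp
  right_inv f := by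
    ext j
    change Complex.exp (Complex.I * d j) * (Complex.exp (-(Complex.I * d j)) * f j) = f j
    rw [← mul_assoc, ← Complex.exp_add]; simp
  norm_map' f := by
    refine (sq_eq_sq₀ (norm_nonneg _) (norm_nonneg _)).1 ?_
    rw [norm_sq_eq, norm_sq_eq]
    refine tsum_congr fun j => ?_
    change ‖Complex.exp (Complex.I * d j) * f j‖ ^ 2 = ‖f j‖ ^ 2
    simp [mul_comm Complex.I, Complex.norm_exp_ofReal_mul_I]

/-- The input phases `u` and output phases `v` are allowed to differ: the gauge changes across `U_e`
and changes back across `U_o`. -/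
theorem blockFun_phase {p : ℤ} {S S' : ℤ → Matrix (Fin 2) (Fin 2) ℂ} {u v : ℤ → ℂ}
    (h00 : ∀ j, Even (j - p) → S j 0 0 * u j = v j * S' j 0 0)
    (h01 : ∀ j, Even (j - p) → S j 0 1 * u (j + 1) = v j * S' j 0 1)
    (h10 : ∀ j, Even (j - p) → S j 1 0 * u j = v (j + 1) * S' j 1 0)
    (h11 : ∀ j, Even (j - p) → S j 1 1 * u (j + 1) = v (j + 1) * S' j 1 1)
    (f : ℤ → ℂ) (j : ℤ) :
    blockFun p S (fun i => u i * f i) j = v j * blockFun p S' f j := by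
  rcases even_or_eq_succ p j with h | ⟨i, h, rfl⟩
  · rw [blockFun_even h, blockFun_even h]
    linear_combination f j * h00 j h + f (j + 1) * h01 j h
  · rw [blockFun_even_succ h, blockFun_even_succ h]
    linear_combination f i * h10 i h + f (i + 1) * h11 i h

theorem scatMatrix_phase (r t : ℝ) {θ α γ θ' α' u₀ u₁ v₀ v₁ : ℝ}
    (h00 : -θ - α + u₀ = v₀ - θ' - α') (h01 : -θ + γ + u₁ = v₀ - θ')
    (h10 : -θ - γ + u₀ = v₁ - θ') (h11 : -θ + α + u₁ = v₁ - θ' + α') :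
    scatMatrix r t θ α γ 0 0 * Complex.exp (Complex.I * u₀)
        = Complex.exp (Complex.I * v₀) * scatMatrix r t θ' α' 0 0 0 ∧
      scatMatrix r t θ α γ 0 1 * Complex.exp (Complex.I * u₁)
        = Complex.exp (Complex.I * v₀) * scatMatrix r t θ' α' 0 0 1 ∧
      scatMatrix r t θ α γ 1 0 * Complex.exp (Complex.I * u₀)
        = Complex.exp (Complex.I * v₁) * scatMatrix r t θ' α' 0 1 0 ∧
      scatMatrix r t θ α γ 1 1 * Complex.exp (Complex.I * u₁)
        = Complex.exp (Complex.I * v₁) * scatMatrix r t θ' α' 0 1 1 := by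
  have key : ∀ a b c a' b' c' : ℝ, a + b + c = c' + a' + b' →
      Complex.exp (Complex.I * a) * Complex.exp (Complex.I * b) * Complex.exp (Complex.I * c) =
        Complex.exp (Complex.I * c') * Complex.exp (Complex.I * a')
          * Complex.exp (Complex.I * b') := by
    intro a b c a' b' c' h
    rw [← Complex.exp_add, ← Complex.exp_add, ← Complex.exp_add, ← Complex.exp_add]
    congr 1
    have : ((a + b + c : ℝ) : ℂ) = ((c' + a' + b' : ℝ) : ℂ) := by rw [h]
    push_cast at this
    linear_combination Complex.I * this
  have e00 := key (-θ) (-α) u₀ (-θ') (-α') v₀ (by linarith)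
  have e01 := key (-θ) γ u₁ (-θ') 0 v₀ (by linarith)
  have e10 := key (-θ) (-γ) u₀ (-θ') 0 v₁ (by linarith)
  have e11 := key (-θ) α u₁ (-θ') α' v₁ (by linarith [h11])
  simp only [Complex.ofReal_neg, mul_neg, Complex.ofReal_zero, mul_zero, Complex.exp_zero,
    mul_one] at e00 e01 e10 e11
  refine ⟨?_, ?_, ?_, ?_⟩ <;> simp [scatMatrix]
  · linear_combination r * e00
  · linear_combination Complex.I * t * e01
  · linear_combination Complex.I * t * e10
  · linear_combination r * e11

theorem exists_sub_eq (c : ℤ → ℝ) : ∃ w : ℤ → ℝ, ∀ j, w (j + 1) = w j + c j := by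
  -- `Int.toNat` truncates negative values to 0, so at most one of the two sums is nonempty.
  refine ⟨fun j => ∑ i ∈ Finset.range j.toNat, c i
    - ∑ i ∈ Finset.range (-j).toNat, c (-(i : ℤ) - 1), fun j => ?_⟩
  obtain ⟨n, rfl | rfl⟩ := j.eq_nat_or_neg
  · have h1 : ((n : ℤ) + 1).toNat = n + 1 := by omega
    have h2 : (-((n : ℤ) + 1)).toNat = 0 := by omega
    have h3 : (-(n : ℤ)).toNat = 0 := by omega
    simp only [h1, h2, h3, Int.toNat_natCast, Finset.sum_range_succ, Finset.sum_range_zero]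
    ring
  · cases n with
    | zero => simp
    | succ n =>
      have h1 : (-((n + 1 : ℕ) : ℤ) + 1).toNat = 0 := by omega
      have h2 : (-(-((n + 1 : ℕ) : ℤ) + 1)).toNat = n := by omega
      have h3 : (-((n + 1 : ℕ) : ℤ)).toNat = 0 := by omega
      have h4 : (- -((n + 1 : ℕ) : ℤ)).toNat = n + 1 := by omega
      simp only [h1, h2, h3, h4, Finset.sum_range_succ, Finset.sum_range_zero]
      have h5 : -(n : ℤ) - 1 = -((n + 1 : ℕ) : ℤ) := by push_cast; ring
      rw [h5]; ring

theorem monodromy_apply (r t : ℝ) (h : r ^ 2 + t ^ 2 = 1) (θ α γ : ℤ → ℝ) (f : L2Z) (j : ℤ) :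
    monodromy r t h θ α γ f j = blockFun 1 (fun k => scatMatrix r t (θ k) (α k) (γ k))
      (blockFun 0 (fun k => scatMatrix r t (θ k) (α k) (γ k)) f) j := rfl

theorem phaseOp_apply (d : ℤ → ℝ) (f : L2Z) (j : ℤ) :
    phaseOp d f j = Complex.exp (Complex.I * d j) * f j := rfl

/-- The phases `γ` and a linear part `a k` of `α` can be gauged away at the cost of a shift of
`θ` by `a / 2`. -/
theorem exists_gauge (r t : ℝ) (h : r ^ 2 + t ^ 2 = 1) (θ γ ϖ : ℤ → ℝ) (a : ℝ) :
    ∃ d : ℤ → ℝ, ∀ f : L2Z,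
      monodromy r t h θ (fun k => a * k + ϖ k) γ (phaseOp d f)
        = phaseOp d (monodromy r t h (fun k => θ k + a / 2) ϖ (fun _ => 0) f) := by
  obtain ⟨w, hw⟩ := exists_sub_eq (fun j => -γ j - a / 2)
  -- Removing `a * j` from the diagonal of block `j` forces input minus output phase to be `a * j -
  -- a / 2` at its left site and `-(a * (j + 1) - a / 2)` at its right site. The shift `a / 2` of
  -- `θ` makes these opposite expressions in the site. Every site is left in one factor and right in
  -- the other, so the phases `e` and `w` are exchanged by `U_e` and exchanged back by `U_o`. The
  -- off-diagonal entries give the recursion for `w`.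
  let e : ℤ → ℝ := fun j => w j + a * j - a / 2
  let d₁ : ℤ → ℝ := fun j => if Even j then e j else w j
  let d₂ : ℤ → ℝ := fun j => if Even j then w j else e j
  have hne : ∀ j : ℤ, Even j → ¬ Even (j + 1) := fun j hj => by
    rw [Int.even_add_one]; simpa using hj
  have ho : ∀ j : ℤ, Even (j - 1) → ¬ Even j := fun j hj => by
    rw [show j = (j - 1) + 1 by ring]; exact hne _ hj
  have ho' : ∀ j : ℤ, Even (j - 1) → Even (j + 1) := fun j hj => by
    rw [show j + 1 = (j - 1) + 2 by ring]; exact hj.add even_two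
  have key₀ : ∀ j : ℤ, Even (j - 0) →
      _ := fun j hj => by
    have hj' : Even j := by simpa using hj
    have := hw j
    exact scatMatrix_phase r t (θ := θ j) (α := a * j + ϖ j) (γ := γ j)
      (θ' := θ j + a / 2) (α' := ϖ j) (u₀ := d₁ j) (u₁ := d₁ (j + 1)) (v₀ := d₂ j)
      (v₁ := d₂ (j + 1))
      (by simp only [d₁, d₂, e, hj', if_true]; ring)
      (by simp only [d₁, d₂, e, hj', hne j hj', if_true, if_false]; linarith)
      (by simp only [d₁, d₂, e, hj', hne j hj', if_true, if_false]; push_cast; linarith)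
      (by simp only [d₁, d₂, e, hne j hj', if_false]; push_cast; ring)
  have key₁ : ∀ j : ℤ, Even (j - 1) →
      _ := fun j hj => by
    have := hw j
    exact scatMatrix_phase r t (θ := θ j) (α := a * j + ϖ j) (γ := γ j)
      (θ' := θ j + a / 2) (α' := ϖ j) (u₀ := d₂ j) (u₁ := d₂ (j + 1)) (v₀ := d₁ j)
      (v₁ := d₁ (j + 1))
      (by simp only [d₁, d₂, e, ho j hj, if_false]; ring)
      (by simp only [d₁, d₂, e, ho j hj, ho' j hj, if_true, if_false]; linarith)
      (by simp only [d₁, d₂, e, ho j hj, ho' j hj, if_true, if_false]; push_cast; linarith)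
      (by simp only [d₁, d₂, e, ho' j hj, if_true]; push_cast; ring)
  refine ⟨d₁, fun f => ?_⟩
  have h₀ := blockFun_phase (p := 0) (S := fun j => scatMatrix r t (θ j) (a * j + ϖ j) (γ j))
    (S' := fun j => scatMatrix r t (θ j + a / 2) (ϖ j) 0)
    (u := fun j => Complex.exp (Complex.I * d₁ j)) (v := fun j => Complex.exp (Complex.I * d₂ j))
    (fun j hj => (key₀ j hj).1) (fun j hj => (key₀ j hj).2.1)
    (fun j hj => (key₀ j hj).2.2.1) (fun j hj => (key₀ j hj).2.2.2) f
  have h₁ := blockFun_phase (p := 1) (S := fun j => scatMatrix r t (θ j) (a * j + ϖ j) (γ j))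
    (S' := fun j => scatMatrix r t (θ j + a / 2) (ϖ j) 0)
    (u := fun j => Complex.exp (Complex.I * d₂ j)) (v := fun j => Complex.exp (Complex.I * d₁ j))
    (fun j hj => (key₁ j hj).1) (fun j hj => (key₁ j hj).2.1)
    (fun j hj => (key₁ j hj).2.2.1) (fun j hj => (key₁ j hj).2.2.2)
    (blockFun 0 (fun j => scatMatrix r t (θ j + a / 2) (ϖ j) 0) f)
  ext j
  rw [monodromy_apply, phaseOp_apply, monodromy_apply, ← h₁ j]
  exact congrArg (fun g => blockFun 1 (fun j => scatMatrix r t (θ j) (a * j + ϖ j) (γ j)) g j)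
    (funext h₀)

/-! ### Bloch sequences -/

section Kernel

variable {m : ℕ}

variable (m) in
/-- Sequences with `f (j + m) = e^{-ix} f j`. -/
def IsBloch (x : Torus) (f : ℤ → ℂ) : Prop := ∀ j, f (j + m) = fourier (-1) x * f j

theorem IsBloch.add_mul {x : Torus} {f : ℤ → ℂ} (hf : IsBloch m x f) (j k : ℤ) :
    f (j + m * k) = fourier (-k) x * f j := by
  induction k using Int.induction_on with
  | zero => simp
  | succ k ih =>
    rw [mul_add, mul_one, ← add_assoc, hf, ih, ← mul_assoc, ← fourier_add]
    congr 3; ring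
  | pred k ih =>
    have := hf (j + m * (-k - 1))
    rw [show j + m * (-(k : ℤ) - 1) + m = j + m * (-k) by ring, ih] at this
    calc f (j + m * (-k - 1))
        = fourier (1 + -1) x * f (j + m * (-k - 1)) := by simp
      _ = fourier 1 x * (fourier (-(-(k : ℤ))) x * f j) := by
        rw [this, fourier_add, mul_assoc]
      _ = _ := by rw [← mul_assoc, ← fourier_add]; congr 3; ring

/-- The kernel of the projection onto sequences with `f (j + m) = e^{-ix} f j`. -/
def blochKernel (m : ℕ) (x : Torus) (i j : ℤ) : ℂ :=
  if (m : ℤ) ∣ i - j then fourier ((j - i) / m) x else 0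

theorem blochKernel_succ_left (x : Torus) (i j : ℤ) :
    blochKernel m x (i + 1) j = blochKernel m x i (j - 1) := by
  simp only [blochKernel, show i + 1 - j = i - (j - 1) by ring, show j - (i + 1) = j - 1 - i by ring]

theorem blochKernel_succ_succ (x : Torus) (i j : ℤ) :
    blochKernel m x (i + 1) (j + 1) = blochKernel m x i j := by
  rw [blochKernel_succ_left, add_sub_cancel_right]

theorem conj_blochKernel (x : Torus) (i j : ℤ) :
    (starRingEnd ℂ) (blochKernel m x i j) = blochKernel m x j i := by
  unfold blochKernel
  by_cases h : (m : ℤ) ∣ i - j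
  · have h' : (m : ℤ) ∣ j - i := (dvd_sub_comm).1 h
    rw [if_pos h, if_pos h', ← fourier_neg, ← neg_sub i j, Int.neg_ediv_of_dvd h, neg_neg]
  · have h' : ¬ (m : ℤ) ∣ j - i := fun h' => h ((dvd_sub_comm).1 h')
    rw [if_neg h, if_neg h', map_zero]

theorem eq_of_blochKernel_ne_zero {A : Type*} {S : ℤ → A} (hS : ∀ k, S (k + m) = S k)
    {x : Torus} {i j : ℤ} (h : blochKernel m x i j ≠ 0) : S i = S j := by
  have hd : (m : ℤ) ∣ i - j := by
    by_contra h'; exact h (if_neg h')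
  obtain ⟨k, hk⟩ := hd
  have hp : Function.Periodic S (m : ℤ) := hS
  have := hp.int_mul k j
  rw [← this]; congr 1; simp; linarith

theorem even_sub_of_blochKernel_ne_zero (hm : Even m) {x : Torus} {i j : ℤ}
    (h : blochKernel m x i j ≠ 0) : Even (i - j) := by
  have hd : (m : ℤ) ∣ i - j := by
    by_contra h'; exact h (if_neg h')
  exact (by exact_mod_cast hm : Even (m : ℤ)).trans_dvd hd

theorem blochKernel_eq_zero (hm : Even m) (x : Torus) {i j : ℤ}
    (h : ¬ Even (i - j)) : blochKernel m x i j = 0 := by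
  by_contra h'; exact h (even_sub_of_blochKernel_ne_zero hm h')

theorem IsBloch.blockFun (hm : Even m) (p : ℤ) {S : ℤ → Matrix (Fin 2) (Fin 2) ℂ}
    (hS : ∀ k, S (k + m) = S k) {x : Torus} {f : ℤ → ℂ} (hf : IsBloch m x f) :
    IsBloch m x (blockFun p S f) := by
  have hm' : Even (m : ℤ) := by exact_mod_cast hm
  intro j
  rcases even_or_eq_succ p j with h | ⟨i, h, rfl⟩
  · have h' : Even (j + m - p) := by
      rw [show j + m - p = j - p + m by ring]; exact h.add hm'
    rw [blockFun_even h, blockFun_even h', hS, hf, show j + m + 1 = j + 1 + m by ring, hf]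
    ring
  · have h' : Even (i + m - p) := by
      rw [show i + m - p = i - p + m by ring]; exact h.add hm'
    rw [show i + 1 + m = i + m + 1 by ring, blockFun_even_succ h, blockFun_even_succ h', hS, hf,
      show i + m + 1 = i + 1 + m by ring, hf]
    ring

theorem analyticOnNhd_fourier (n : ℤ) :
    AnalyticOnNhd ℝ (fun x : ℝ => fourier n (x : Torus)) Set.univ := by
  have : (fun x : ℝ => fourier n (x : Torus)) =
      fun x : ℝ => Complex.exp (2 * Real.pi * Complex.I * n * x / (2 * Real.pi : ℝ)) := by
    funext x; rw [fourier_coe_apply]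
  rw [this]
  intro x _
  have h : AnalyticAt ℝ (fun x : ℝ => (x : ℂ)) x := Complex.ofRealCLM.analyticAt x
  refine AnalyticAt.comp (g := Complex.exp) (analyticAt_cexp.restrictScalars) ?_
  exact (analyticAt_const.mul h).div_const

theorem analyticOnNhd_blochKernel (i j : ℤ) :
    AnalyticOnNhd ℝ (fun x : ℝ => blochKernel m (x : Torus) i j) Set.univ := by
  unfold blochKernel
  split_ifs
  · exact analyticOnNhd_fourier _
  · exact analyticOnNhd_const

/-- With `K` the Hermitian Bloch kernel, this is `(S K)* = S* K`: a periodic block operator commutes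
with `K`. It yields both the adjoint of a symbol and the action of an operator on the columns of
`K`. -/
theorem conj_blockFun_blochKernel (hm : Even m) (p : ℤ) {S : ℤ → Matrix (Fin 2) (Fin 2) ℂ}
    (hS : ∀ k, S (k + m) = S k) (x : Torus) (i l : ℤ) :
    (starRingEnd ℂ) (blockFun p S (fun j => blochKernel m x j i) l)
      = blockFun p (fun j => (S j).conjTranspose) (fun j => blochKernel m x j l) i := by
  have hk : ∀ i l : ℤ, ∀ a b : Fin 2, (starRingEnd ℂ) (S l a b) * blochKernel m x i l
      = (starRingEnd ℂ) (S i a b) * blochKernel m x i l := by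
    intro i l a b
    by_cases h : blochKernel m x i l = 0
    · simp [h]
    · rw [eq_of_blochKernel_ne_zero hS h]
  -- Left and right sites of blocks have opposite parity, and for even `m` the kernel links only
  -- sites of equal parity.
  have h1 : ∀ {i l : ℤ}, Even (i - p) → Even (l - p) → blochKernel m x i (l + 1) = 0 := by
    intro i l hi hl
    apply blochKernel_eq_zero hm
    rw [show i - (l + 1) = (i - p) - (l - p) - 1 by ring]
    exact Int.not_even_iff_odd.2 ((hi.sub hl).sub_odd odd_one)
  have h2 : ∀ {i l : ℤ}, Even (i - p) → Even (l - p) → blochKernel m x (i + 1) l = 0 := by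
    intro i l hi hl
    apply blochKernel_eq_zero hm
    rw [show (i + 1) - l = (i - p) - (l - p) + 1 by ring]
    exact Int.not_even_iff_odd.2 ((hi.sub hl).add_odd odd_one)
  rcases even_or_eq_succ p l with hl | ⟨l, hl, rfl⟩ <;>
  rcases even_or_eq_succ p i with hi | ⟨i, hi, rfl⟩
  · rw [blockFun_even hl, blockFun_even hi]
    simp only [map_add, map_mul, conj_blochKernel, Matrix.conjTranspose_apply, h1 hi hl, h2 hi hl,
      mul_zero, add_zero]
    exact hk i l _ _
  · rw [blockFun_even hl, blockFun_even_succ hi]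
    simp only [map_add, map_mul, conj_blochKernel, Matrix.conjTranspose_apply, h2 hi hl,
      blochKernel_succ_succ, mul_zero, add_zero, zero_add]
    exact hk i l _ _
  · rw [blockFun_even_succ hl, blockFun_even hi]
    simp only [map_add, map_mul, conj_blochKernel, Matrix.conjTranspose_apply, h1 hi hl,
      blochKernel_succ_succ, mul_zero, add_zero, zero_add]
    exact hk i l _ _
  · rw [blockFun_even_succ hl, blockFun_even_succ hi]
    simp only [map_add, map_mul, conj_blochKernel, Matrix.conjTranspose_apply, h1 hi hl, h2 hi hl,
      blochKernel_succ_succ, mul_zero, zero_add]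
    exact hk i l _ _

end Kernel

/-- The class of `j` modulo `m`. -/
def cell (m : ℕ) [NeZero m] (j : ℤ) : Fin m :=
  ⟨(j % m).toNat, by
    have hm : (0 : ℤ) < m := by exact_mod_cast Nat.pos_of_neZero m
    have := Int.emod_nonneg j hm.ne'
    have := Int.emod_lt_of_pos j hm
    omega⟩

/-! ### Bloch sequences as vectors of `ℂᵐ` -/

section Bloch

variable {m : ℕ} [NeZero m]

theorem natCast_pos_int : (0 : ℤ) < m := by exact_mod_cast Nat.pos_of_neZero m

theorem coe_cell (j : ℤ) : ((cell m j : ℕ) : ℤ) = j % m :=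
  Int.toNat_of_nonneg (Int.emod_nonneg j (natCast_pos_int (m := m)).ne')

@[simp] theorem cell_coe (i : Fin m) : cell m (i : ℕ) = i := by
  apply Fin.ext
  have := coe_cell (m := m) (i : ℕ)
  rw [Int.emod_eq_of_lt (by positivity) (by exact_mod_cast i.2)] at this
  exact_mod_cast this

theorem cell_eq_cell_iff (i j : ℤ) : cell m i = cell m j ↔ (m : ℤ) ∣ i - j := by
  rw [Fin.ext_iff, ← Nat.cast_inj (R := ℤ), coe_cell, coe_cell]
  rw [Int.emod_eq_emod_iff_emod_sub_eq_zero, Int.dvd_iff_emod_eq_zero]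

variable (m) in
/-- The quasi-periodic extension of a vector to a sequence with `f (j + m) = e^{-ix} f j`. -/
def blochExt (x : Torus) : (Fin m → ℂ) →ₗ[ℂ] (ℤ → ℂ) where
  toFun v j := fourier (-(j / m)) x * v (cell m j)
  map_add' v w := by funext j; simp [mul_add]
  map_smul' c v := by funext j; simp [mul_left_comm]

theorem blochExt_apply (x : Torus) (v : Fin m → ℂ) (j : ℤ) :
    blochExt m x v j = fourier (-(j / m)) x * v (cell m j) := rfl

theorem blochExt_coe (x : Torus) (v : Fin m → ℂ) (i : Fin m) :
    blochExt m x v (i : ℕ) = v i := by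
  rw [blochExt_apply, cell_coe, Int.ediv_eq_zero_of_lt (by positivity) (by exact_mod_cast i.2)]
  simp

theorem isBloch_blochExt (x : Torus) (v : Fin m → ℂ) : IsBloch m x (blochExt m x v) := by
  intro j
  have h : cell m (j + m) = cell m j := by rw [cell_eq_cell_iff]; simp
  rw [blochExt_apply, blochExt_apply, h, Int.add_ediv_of_dvd_right dvd_rfl,
    Int.ediv_self (natCast_pos_int (m := m)).ne', ← mul_assoc, ← fourier_add]
  congr 3; ring

theorem IsBloch.eq_blochExt {x : Torus} {f : ℤ → ℂ} (hf : IsBloch m x f) :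
    blochExt m x (fun i => f (i : ℕ)) = f := by
  funext j
  rw [blochExt_apply, coe_cell, ← hf.add_mul, Int.emod_add_mul_ediv]

theorem blochExt_eq_blochKernel (x : Torus) (i j : ℤ) :
    blochExt m x (fourier (j / m) x • Pi.single (cell m j) 1) i = blochKernel m x i j := by
  rw [blochExt_apply, Pi.smul_apply, Pi.single_apply, blochKernel]
  simp only [cell_eq_cell_iff]
  split_ifs with h
  · rw [smul_eq_mul, mul_one, ← fourier_add]
    obtain ⟨k, hk⟩ := h
    obtain rfl : i = j + k * m := by linarith
    rw [Int.add_mul_ediv_right _ _ (natCast_pos_int (m := m)).ne',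
      show j - (j + k * m) = -k * m by ring,
      Int.mul_ediv_cancel _ (natCast_pos_int (m := m)).ne']
    congr 2; ring
  · simp

theorem blochExt_single (x : Torus) (i : ℤ) (l : Fin m) :
    blochExt m x (Pi.single l 1) i = blochKernel m x i (l : ℕ) := by
  rw [← blochExt_eq_blochKernel, cell_coe,
    Int.ediv_eq_zero_of_lt (by positivity) (by exact_mod_cast l.2)]
  simp

/-! ### The symbols of block diagonal operators -/

/-- `blockFun` as a linear map. -/
def blockLin (p : ℤ) (S : ℤ → Matrix (Fin 2) (Fin 2) ℂ) : (ℤ → ℂ) →ₗ[ℂ] (ℤ → ℂ) where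
  toFun := blockFun p S
  map_add' f g := by
    funext j
    simp only [blockFun, Pi.add_apply]
    split_ifs <;> ring
  map_smul' c f := by
    funext j
    simp only [blockFun, Pi.smul_apply, smul_eq_mul, RingHom.id_apply]
    split_ifs <;> ring

variable (m) in
/-- The symbol at `x` of the block diagonal operator `blockFun p S`: its restriction to the
sequences with `f (j + m) = e^{-ix} f j`. -/
def symbol (p : ℤ) (S : ℤ → Matrix (Fin 2) (Fin 2) ℂ) (x : Torus) : Matrix (Fin m) (Fin m) ℂ :=
  LinearMap.toMatrix' (LinearMap.funLeft ℂ ℂ (fun i : Fin m => ((i : ℕ) : ℤ)) ∘ₗ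
    blockLin p S ∘ₗ blochExt m x)

theorem symbol_mulVec (p : ℤ) (S : ℤ → Matrix (Fin 2) (Fin 2) ℂ) (x : Torus) (v : Fin m → ℂ) :
    (symbol m p S x).mulVec v = fun i : Fin m => blockFun p S (blochExt m x v) (i : ℕ) := by
  rw [symbol, LinearMap.toMatrix'_mulVec]; rfl

theorem symbol_apply (p : ℤ) (S : ℤ → Matrix (Fin 2) (Fin 2) ℂ) (x : Torus) (i l : Fin m) :
    symbol m p S x i l = blockFun p S (fun j => blochKernel m x j (l : ℕ)) (i : ℕ) := by
  change (symbol m p S x).col l i = _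
  rw [← Matrix.mulVec_single_one, symbol_mulVec]
  refine congrArg (fun f => blockFun p S f (i : ℕ)) ?_
  funext j
  exact blochExt_single x j l

/-- Periodicity, together with the evenness of `m`, keeps the image a Bloch sequence, and such a
sequence is determined by its values on `0, …, m - 1`. Products of symbols thereby reduce to
products of block operators. -/
theorem blochExt_symbol_mulVec (hm : Even m) (p : ℤ) {S : ℤ → Matrix (Fin 2) (Fin 2) ℂ}
    (hS : ∀ k, S (k + m) = S k) (x : Torus) (v : Fin m → ℂ) :
    blochExt m x ((symbol m p S x).mulVec v) = blockFun p S (blochExt m x v) := by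
  rw [symbol_mulVec, ((isBloch_blochExt x v).blockFun hm p hS).eq_blochExt]

theorem symbol_mul (hm : Even m) (p : ℤ) (S : ℤ → Matrix (Fin 2) (Fin 2) ℂ)
    {S' : ℤ → Matrix (Fin 2) (Fin 2) ℂ} (hS' : ∀ k, S' (k + m) = S' k) (x : Torus) :
    symbol m p S x * symbol m p S' x = symbol m p (fun j => S j * S' j) x := by
  apply Matrix.toLin'.injective
  ext1 l
  ext1
  simp only [Matrix.toLin'_mul, LinearMap.comp_apply, Matrix.toLin'_apply]
  rw [symbol_mulVec _ S, blochExt_symbol_mulVec hm p hS', blockFun_mul, symbol_mulVec]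

theorem symbol_one (p : ℤ) (x : Torus) : symbol m p (fun _ => 1) x = 1 := by
  apply Matrix.toLin'.injective
  ext1 l
  ext1
  simp only [LinearMap.comp_apply, Matrix.toLin'_apply, Matrix.one_mulVec]
  rw [symbol_mulVec, blockFun_one]
  funext i
  exact blochExt_coe x _ i

theorem conjTranspose_symbol (hm : Even m) (p : ℤ) {S : ℤ → Matrix (Fin 2) (Fin 2) ℂ}
    (hS : ∀ k, S (k + m) = S k) (x : Torus) :
    (symbol m p S x).conjTranspose = symbol m p (fun j => (S j).conjTranspose) x := by
  ext i l
  rw [Matrix.conjTranspose_apply, symbol_apply, symbol_apply]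
  exact conj_blockFun_blochKernel hm p hS x _ _

theorem symbol_mem_unitaryGroup (hm : Even m) (p : ℤ) {S : ℤ → Matrix (Fin 2) (Fin 2) ℂ}
    (hS : ∀ k, S (k + m) = S k) (hU : ∀ k, S k ∈ Matrix.unitaryGroup (Fin 2) ℂ) (x : Torus) :
    symbol m p S x ∈ Matrix.unitaryGroup (Fin m) ℂ := by
  rw [Matrix.mem_unitaryGroup_iff, Matrix.star_eq_conjTranspose, conjTranspose_symbol hm p hS,
    symbol_mul hm p S (fun k => by rw [hS])]
  have : (fun j => S j * (S j).conjTranspose) = fun _ => (1 : Matrix (Fin 2) (Fin 2) ℂ) :=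
    funext fun j => Matrix.mem_unitaryGroup_iff.1 (hU j)
  rw [this, symbol_one]

theorem analyticOnNhd_symbol (p : ℤ) (S : ℤ → Matrix (Fin 2) (Fin 2) ℂ) (i l : Fin m) :
    AnalyticOnNhd ℝ (fun x : ℝ => symbol m p S (x : Torus) i l) Set.univ := by
  have h := fun (c : ℂ) (j : ℤ) => (analyticOnNhd_const (𝕜 := ℝ) (v := c)
    (s := (Set.univ : Set ℝ))).mul (analyticOnNhd_blochKernel (m := m) j (l : ℕ))
  simp only [symbol_apply, Monodromy.blockFun]
  split_ifs
  · exact (h _ _).add (h _ _)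
  · exact (h _ _).add (h _ _)

end Bloch

/-! ### Transfer matrices -/

/-- The transfer matrix of a block of `U_e`, from `(ψ_j, χ_j)` to `(ψ_{j+1}, χ_{j+1})`, where
`χ = U_e ψ`. -/
def transferEven (S : Matrix (Fin 2) (Fin 2) ℂ) : Matrix (Fin 2) (Fin 2) ℂ :=
  !![-(S 0 0 / S 0 1), 1 / S 0 1; S 1 0 - S 0 0 * S 1 1 / S 0 1, S 1 1 / S 0 1]

/-- The transfer matrix of a block of `U_o`, from `(ψ_j, χ_j)` to `(ψ_{j+1}, χ_{j+1})`, where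
`U_o χ = z ψ`. -/
def transferOdd (S : Matrix (Fin 2) (Fin 2) ℂ) (z : ℂ) : Matrix (Fin 2) (Fin 2) ℂ :=
  !![S 1 1 / S 0 1, (S 1 0 - S 0 0 * S 1 1 / S 0 1) * z⁻¹; z / S 0 1, -(S 0 0 / S 0 1)]

/-- The transfer matrix from `(ψ_0, χ_0)` to `(ψ_n, χ_n)` for solutions of `U_o U_e ψ = z ψ`. -/
def transfer (S : ℤ → Matrix (Fin 2) (Fin 2) ℂ) (z : ℂ) : ℕ → Matrix (Fin 2) (Fin 2) ℂ
  | 0 => 1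
  | n + 1 => (if Even n then transferEven (S n) else transferOdd (S n) z) * transfer S z n

/-- A block gives two linear equations between the values of `ψ` and `χ` at its two sites; as the
upper right entry is nonzero, they can be solved for the values at the right site. -/
theorem transfer_mulVec {S : ℤ → Matrix (Fin 2) (Fin 2) ℂ} (hS : ∀ k, S k 0 1 ≠ 0) {z : ℂ}
    (hz : z ≠ 0) {ψ χ : ℤ → ℂ} (h₀ : blockFun 0 S ψ = χ) (h₁ : blockFun 1 S χ = z • ψ) (n : ℕ) :
    (transfer S z n).mulVec ![ψ 0, χ 0] = ![ψ n, χ n] := by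
  induction n with
  | zero => simp [transfer]
  | succ n ih =>
    rw [transfer, ← Matrix.mulVec_mulVec, ih]
    have hn := hS n
    split_ifs with hp
    · have hp' : Even ((n : ℤ) - 0) := by simpa using hp
      have e1 : χ n = _ := h₀ ▸ blockFun_even (S := S) (f := ψ) hp'
      have e2 : χ (n + 1) = _ := h₀ ▸ blockFun_even_succ (S := S) (f := ψ) hp'
      ext i
      fin_cases i <;> simp [transferEven, Matrix.mulVec, dotProduct, Fin.sum_univ_two]
      · rw [e1]; field_simp; ring
      · rw [e2, e1]; field_simp; ring
    · have hp' : Even ((n : ℤ) - 1) := by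
        rw [Nat.not_even_iff_odd] at hp
        exact (by exact_mod_cast hp : Odd (n : ℤ)).sub_odd odd_one
      have e1 : z * ψ n = _ := (congrFun h₁ n).symm.trans (blockFun_even (S := S) (f := χ) hp')
      have e2 : z * ψ (n + 1) = _ :=
        (congrFun h₁ (n + 1)).symm.trans (blockFun_even_succ (S := S) (f := χ) hp')
      ext i
      fin_cases i <;> simp [transferOdd, Matrix.mulVec, dotProduct, Fin.sum_univ_two]
      · field_simp
        linear_combination S n 1 1 * e1 - S n 0 1 * e2
      · field_simp
        linear_combination e1

/-- Both kinds of transfer matrix have determinant `-(S 1 0 / S 0 1)`, which is `-1` when the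
off-diagonal entries agree. -/
theorem det_transfer {S : ℤ → Matrix (Fin 2) (Fin 2) ℂ} (hS : ∀ k, S k 0 1 ≠ 0)
    (hS' : ∀ k, S k 1 0 = S k 0 1) {z : ℂ} (hz : z ≠ 0) (n : ℕ) :
    (transfer S z n).det = (-1) ^ n := by
  induction n with
  | zero => simp [transfer]
  | succ n ih =>
    rw [transfer, Matrix.det_mul, ih, pow_succ, mul_comm]
    have hn := hS n
    congr 1
    split_ifs <;> simp [transferEven, transferOdd, Matrix.det_fin_two, hS'] <;> field_simp <;> ring

/-- The entries are Laurent polynomials in `z`. Differentiability along the unit circle is what lets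
the discriminant preserve null sets. -/
theorem differentiable_transfer (S : ℤ → Matrix (Fin 2) (Fin 2) ℂ) (n : ℕ) (i j : Fin 2) :
    Differentiable ℝ fun y : ℝ => transfer S (Complex.exp (Complex.I * y)) n i j := by
  induction n generalizing i j with
  | zero => exact differentiable_const _
  | succ n ih =>
    have h0 : Differentiable ℝ (fun y : ℝ => Complex.exp (Complex.I * y)) := by
      have : Differentiable ℝ (fun y : ℝ => (y : ℂ)) := Complex.ofRealCLM.differentiable
      fun_prop
    have h1 : Differentiable ℝ (fun y : ℝ => (Complex.exp (Complex.I * y))⁻¹) :=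
      h0.inv fun _ => Complex.exp_ne_zero _
    have key : ∀ i j, Differentiable ℝ (fun y : ℝ => (if Even n then transferEven (S n)
        else transferOdd (S n) (Complex.exp (Complex.I * y))) i j) := by
      intro i j
      split_ifs
      · exact differentiable_const _
      · fin_cases i <;> fin_cases j <;> simp [transferOdd]
        · exact h1.const_mul _
        · exact h0.div_const _
    simp only [transfer, Matrix.mul_apply, Fin.sum_univ_two]
    exact ((key i 0).mul (ih 0 j)).add ((key i 1).mul (ih 1 j))

theorem quadratic_of_mulVec_eq_smul {M : Matrix (Fin 2) (Fin 2) ℂ} {ζ : ℂ} {u : Fin 2 → ℂ}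
    (hu : u ≠ 0) (h : M.mulVec u = ζ • u) : ζ ^ 2 - M.trace * ζ + M.det = 0 := by
  have h' : (M - ζ • (1 : Matrix (Fin 2) (Fin 2) ℂ)).mulVec u = 0 := by
    rw [Matrix.sub_mulVec, h, Matrix.smul_mulVec, Matrix.one_mulVec, sub_self]
  have := Matrix.exists_mulVec_eq_zero_iff.1 ⟨u, hu, h'⟩
  rw [Matrix.det_fin_two] at this
  simp at this
  rw [Matrix.trace_fin_two, Matrix.det_fin_two]
  linear_combination this

/-! ### The discriminant relation -/

section Discriminant

variable {m : ℕ} [NeZero m]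

/-- The Bloch condition makes `ζ = e^{-ix}` an eigenvalue of the transfer matrix over one period.
Its determinant is 1 because `m` is even, so `ζ² - τ ζ + 1 = 0` with `τ` the trace, that is, `τ = ζ
+ ζ⁻¹`. -/
theorem trace_transfer_of_hasEigenvalue (hm : Even m) {S : ℤ → Matrix (Fin 2) (Fin 2) ℂ}
    (hS : ∀ k, S (k + m) = S k) (hS0 : ∀ k, S k 0 1 ≠ 0) (hS' : ∀ k, S k 1 0 = S k 0 1)
    {z : ℂ} (hz : z ≠ 0) {x : Torus}
    (h : Module.End.HasEigenvalue (Matrix.toLin' (symbol m 1 S x * symbol m 0 S x)) z) :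
    fourier 1 x + fourier (-1) x = (transfer S z m).trace := by
  obtain ⟨v, hv⟩ := h.exists_hasEigenvector
  have hv0 := hv.2
  have hve : (symbol m 1 S x).mulVec ((symbol m 0 S x).mulVec v) = z • v := by
    rw [Matrix.mulVec_mulVec, ← Matrix.toLin'_apply]; exact hv.apply_eq_smul
  have h₀ := blochExt_symbol_mulVec hm 0 hS x v
  have h₁ := blochExt_symbol_mulVec hm 1 hS x ((symbol m 0 S x).mulVec v)
  rw [hve, map_smul] at h₁
  set ψ := blochExt m x v
  set χ := blochExt m x ((symbol m 0 S x).mulVec v)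
  have hT := transfer_mulVec hS0 hz h₀.symm h₁.symm
  -- Vanishing data at site 0 would propagate to `ψ = 0` on `0, …, m - 1`, where `ψ` coincides with
  -- the eigenvector.
  have hu : ![ψ 0, χ 0] ≠ 0 := by
    intro hu
    apply hv0
    funext i
    have := congrFun (hT (i : ℕ)) 0
    rw [hu, Matrix.mulVec_zero] at this
    rw [← blochExt_coe x v i]
    exact this.symm
  have hψ : ψ m = fourier (-1) x * ψ 0 := by
    have := isBloch_blochExt (m := m) x v 0
    rwa [zero_add] at this
  have hχ : χ m = fourier (-1) x * χ 0 := by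
    have := isBloch_blochExt (m := m) x ((symbol m 0 S x).mulVec v) 0
    rwa [zero_add] at this
  have hM : (transfer S z m).mulVec ![ψ 0, χ 0] = (fourier (-1) x : ℂ) • ![ψ 0, χ 0] := by
    rw [hT m, hψ, hχ]; simp
  have hq := quadratic_of_mulVec_eq_smul hu hM
  rw [det_transfer hS0 hS' hz, hm.neg_one_pow] at hq
  have h1 : (fourier 1 x : ℂ) * fourier (-1) x = 1 := by rw [← fourier_add]; simp
  linear_combination (fourier 1 x : ℂ) * hq
    - ((fourier (-1) x : ℂ) - (transfer S z m).trace) * h1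

/-- `e^{ix}` is a root of `X² - τ X + 1`, and `x ↦ e^{ix}` is injective on the torus. -/
theorem finite_setOf_fourier_add_eq (τ : ℂ) :
    {x : Torus | fourier 1 x + fourier (-1) x = τ}.Finite := by
  have hinj : Function.Injective (fun x : Torus => (fourier 1 x : ℂ)) := by
    intro x y hxy
    simp only [fourier_one] at hxy
    exact AddCircle.injective_toCircle (by positivity) (Subtype.coe_injective hxy)
  let q : Polynomial ℂ := Polynomial.X ^ 2 - Polynomial.C τ * Polynomial.X + 1
  have hq : q ≠ 0 := by
    intro h
    have := congrArg (Polynomial.eval 0) h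
    simp [q] at this
  refine ((q.roots.toFinset.finite_toSet).preimage hinj.injOn).subset fun x hx => ?_
  have hx : (fourier 1 x : ℂ) + fourier (-1) x = τ := hx
  have h1 : (fourier 1 x : ℂ) * fourier (-1) x = 1 := by rw [← fourier_add]; simp
  simp only [Set.mem_preimage, Finset.mem_coe, Multiset.mem_toFinset, Polynomial.mem_roots hq,
    Polynomial.IsRoot, q, Polynomial.eval_add, Polynomial.eval_sub, Polynomial.eval_pow,
    Polynomial.eval_mul, Polynomial.eval_X, Polynomial.eval_C, Polynomial.eval_one]
  linear_combination (fourier 1 x : ℂ) * hx - h1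

theorem ne_zero_of_hasEigenvalue {n : ℕ} {Q : Matrix (Fin n) (Fin n) ℂ}
    (hQ : Q ∈ Matrix.unitaryGroup (Fin n) ℂ) {c : ℂ}
    (h : Module.End.HasEigenvalue (Matrix.toLin' Q) c) : c ≠ 0 := by
  rintro rfl
  obtain ⟨v, hv⟩ := h.exists_hasEigenvector
  apply hv.2
  have h0 : Q.mulVec v = 0 := by
    rw [← Matrix.toLin'_apply, hv.apply_eq_smul, zero_smul]
  rw [← Matrix.one_mulVec v, ← Matrix.mem_unitaryGroup_iff'.1 hQ, ← Matrix.mulVec_mulVec, h0,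
    Matrix.mulVec_zero]

theorem finite_setOf_hasEigenvalue (hm : Even m) {S : ℤ → Matrix (Fin 2) (Fin 2) ℂ}
    (hS : ∀ k, S (k + m) = S k) (hU : ∀ k, S k ∈ Matrix.unitaryGroup (Fin 2) ℂ)
    (hS0 : ∀ k, S k 0 1 ≠ 0) (hS' : ∀ k, S k 1 0 = S k 0 1) (c : ℂ) :
    {x : Torus | Module.End.HasEigenvalue
      (Matrix.toLin' (symbol m 1 S x * symbol m 0 S x)) c}.Finite :=
  (finite_setOf_fourier_add_eq (transfer S c m).trace).subset fun x hx =>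
    trace_transfer_of_hasEigenvalue hm hS hS0 hS'
      (ne_zero_of_hasEigenvalue (mul_mem (symbol_mem_unitaryGroup hm 1 hS hU x)
        (symbol_mem_unitaryGroup hm 0 hS hU x)) hx) hx

end Discriminant

/-! ### Null sets -/

/-- Off the countable set `sin x = 0`, each `x` is `± arccos (cos x) + 2kπ` for some integer `k`. On
`(-1, 1)` the function `arccos` is differentiable, so it maps null sets to null sets, and there are
countably many branches. -/
theorem volume_setOf_two_mul_cos_mem {B : Set ℝ} (hB : volume B = 0) :
    volume {x : ℝ | 2 * Real.cos x ∈ B} = 0 := by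
  let C : Set ℝ := ((fun b => 2 * b) ⁻¹' B) ∩ Set.Ioo (-1) 1
  have hC : volume C = 0 := by
    refine measure_mono_null Set.inter_subset_left ?_
    rw [Real.volume_preimage_mul_left (by norm_num), hB, mul_zero]
  let G : Set ℝ := Real.arccos '' C
  have hG : volume G = 0 := by
    refine addHaar_image_eq_zero_of_differentiableOn_of_addHaar_eq_zero volume (fun b hb => ?_) hC
    exact (Real.differentiableAt_arccos.2
      ⟨hb.2.1.ne', hb.2.2.ne⟩).differentiableWithinAt
  have hsub : {x : ℝ | 2 * Real.cos x ∈ B} ⊆ (Set.range fun n : ℤ => (n : ℝ) * Real.pi) ∪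
      ((⋃ k : ℤ, (fun x => x + 2 * k * Real.pi) ⁻¹' G)
        ∪ ⋃ k : ℤ, (fun x => 2 * k * Real.pi - x) ⁻¹' G) := by
    intro x hx
    by_cases hs : Real.sin x = 0
    · obtain ⟨n, hn⟩ := Real.sin_eq_zero_iff.1 hs
      exact Or.inl ⟨n, hn⟩
    · right
      have hsq := Real.sin_sq_add_cos_sq x
      have hpos : 0 < Real.sin x ^ 2 := by positivity
      have hC' : Real.cos x ∈ C := ⟨hx, by nlinarith, by nlinarith⟩
      have hG' : Real.arccos (Real.cos x) ∈ G := ⟨_, hC', rfl⟩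
      have hc : Real.cos x = Real.cos (Real.arccos (Real.cos x)) :=
        (Real.cos_arccos (Real.neg_one_le_cos x) (Real.cos_le_one x)).symm
      obtain ⟨k, hk | hk⟩ := Real.cos_eq_cos_iff.1 hc
      · left
        refine Set.mem_iUnion.2 ⟨k, ?_⟩
        rw [hk] at hG'
        simpa [add_comm] using hG'
      · right
        refine Set.mem_iUnion.2 ⟨k, ?_⟩
        rw [hk] at hG'
        simpa using hG'
  refine measure_mono_null hsub ?_
  rw [measure_union_null_iff, measure_union_null_iff, measure_iUnion_null_iff,
    measure_iUnion_null_iff]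
  refine ⟨(Set.countable_range _).measure_zero _, fun k => ?_, fun k => ?_⟩
  · rw [measure_preimage_add_right, hG]
  · rw [(Measure.measurePreserving_sub_left volume (2 * k * Real.pi)).measure_preimage
      (NullMeasurableSet.of_null hG), hG]

theorem fourier_one_add_fourier_neg_one (x : ℝ) :
    (fourier 1 (x : Torus) + fourier (-1) (x : Torus) : ℂ) = (2 * Real.cos x : ℝ) := by
  rw [fourier_neg, Complex.add_conj, fourier_coe_apply]
  have : 2 * Real.pi * Complex.I * (1 : ℤ) * x / (2 * Real.pi : ℝ) = x * Complex.I := by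
    have : (Real.pi : ℂ) ≠ 0 := by exact_mod_cast Real.pi_ne_zero
    push_cast; field_simp
  rw [this, Complex.exp_ofReal_mul_I_re]

theorem ae_fourier_add_ne {D : ℝ → ℝ} (hD : Differentiable ℝ D) {A : Set Torus}
    (hA : volume A = 0) :
    ∀ᵐ x : Torus, ∀ y ∈ Set.Ioc 0 (0 + 2 * Real.pi), (y : Torus) ∈ A →
      (fourier 1 x + fourier (-1) x : ℂ) ≠ D y := by
  have hmp := AddCircle.measurePreserving_mk (2 * Real.pi) 0
  let A' : Set ℝ := ((↑) : ℝ → Torus) ⁻¹' A ∩ Set.Ioc 0 (0 + 2 * Real.pi)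
  have hA' : volume A' = 0 := by
    rw [← Measure.restrict_apply' measurableSet_Ioc]
    rw [hmp.measure_preimage (NullMeasurableSet.of_null hA), hA]
  have hB : volume (D '' A') = 0 :=
    addHaar_image_eq_zero_of_differentiableOn_of_addHaar_eq_zero volume hD.differentiableOn hA'
  -- The image `D '' A'` need not be measurable; a measurable null hull makes `Y` measurable, so its
  -- measure can be computed on the interval `(0, 2π]`.
  let B := toMeasurable volume (D '' A')
  have hB' : volume B = 0 := by rw [measure_toMeasurable, hB]
  let Y : Set Torus := {x | (fourier 1 x + fourier (-1) x : ℂ).re ∈ B}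
  have hYm : MeasurableSet Y := by
    refine measurableSet_preimage (Continuous.measurable ?_) (measurableSet_toMeasurable _ _)
    exact Complex.continuous_re.comp ((map_continuous (fourier 1)).add (map_continuous _))
  have hY : volume Y = 0 := by
    rw [← hmp.measure_preimage hYm.nullMeasurableSet]
    refine measure_mono_null (fun x hx => ?_)
      (Measure.absolutelyContinuous_of_le Measure.restrict_le_self
        (volume_setOf_two_mul_cos_mem hB'))
    have hx : (fourier 1 (x : Torus) + fourier (-1) (x : Torus) : ℂ).re ∈ B := hx
    rwa [fourier_one_add_fourier_neg_one, Complex.ofReal_re] at hx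
  filter_upwards [measure_eq_zero_iff_ae_notMem.1 hY] with x hx y hy hyA hxy
  apply hx
  change (fourier 1 x + fourier (-1) x : ℂ).re ∈ B
  rw [hxy, Complex.ofReal_re]
  exact subset_toMeasurable _ _ ⟨y, ⟨hyA, hy⟩, rfl⟩

/-- For almost every `x`, the spectrum of the symbol at `x` avoids a given null set. -/
theorem ae_not_hasEigenvalue {m : ℕ} [NeZero m] (hm : Even m) {S : ℤ → Matrix (Fin 2) (Fin 2) ℂ}
    (hS : ∀ k, S (k + m) = S k) (hS0 : ∀ k, S k 0 1 ≠ 0) (hS' : ∀ k, S k 1 0 = S k 0 1)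
    {A : Set Torus} (hA : volume A = 0) :
    ∀ᵐ x : Torus, ∀ y ∈ A, ¬ Module.End.HasEigenvalue
      (Matrix.toLin' (symbol m 1 S x * symbol m 0 S x)) (fourier 1 y) := by
  -- The trace may be complex for general `y`. Wherever an eigenvalue occurs it equals `2 cos x`, so
  -- passing to the real part loses nothing.
  let D : ℝ → ℝ := fun y => ((transfer S (Complex.exp (Complex.I * y)) m).trace).re
  have hD : Differentiable ℝ D := by
    have : Differentiable ℝ fun y : ℝ => (transfer S (Complex.exp (Complex.I * y)) m).trace := by
      simp only [Matrix.trace_fin_two]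
      exact (differentiable_transfer S m 0 0).add (differentiable_transfer S m 1 1)
    exact Complex.reCLM.differentiable.comp this
  filter_upwards [ae_fourier_add_ne hD hA] with x hx y hy he
  obtain ⟨y, hy0, rfl⟩ : ∃ y' ∈ Set.Ioc 0 (0 + 2 * Real.pi), (y' : Torus) = y := by
    have := AddCircle.coe_image_Ioc_eq (2 * Real.pi) 0
    exact (Set.ext_iff.1 this y).2 trivial
  have h1 : (fourier 1 (y : Torus) : ℂ) = Complex.exp (Complex.I * y) := by
    have : (Real.pi : ℂ) ≠ 0 := by exact_mod_cast Real.pi_ne_zero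
    rw [fourier_coe_apply]
    congr 1
    push_cast; field_simp
  rw [h1] at he
  have htr := trace_transfer_of_hasEigenvalue hm hS hS0 hS' (Complex.exp_ne_zero _) he
  refine hx y hy0 hy ?_
  obtain ⟨x, rfl⟩ := QuotientAddGroup.mk_surjective x
  replace htr : (fourier 1 (x : Torus) + fourier (-1) (x : Torus) : ℂ) = _ := htr
  rw [fourier_one_add_fourier_neg_one] at htr ⊢
  simp only [D, ← htr, Complex.ofReal_re]

/-! ### The Fourier basis of `L²(𝕋; ℂᵐ)` -/

section FourierBasis

variable {m : ℕ} [NeZero m]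

/-- The vectors of the Fourier basis of `L²(𝕋; ℂᵐ)` as continuous functions, indexed by `ℤ`. -/
def fourierVec (m : ℕ) [NeZero m] (j : ℤ) : C(Torus, EuclideanSpace ℂ (Fin m)) where
  toFun x := ((√(2 * Real.pi))⁻¹ : ℂ) • (fourier (j / m) x : ℂ) •
    EuclideanSpace.single (cell m j) (1 : ℂ)
  continuous_toFun := by fun_prop

/-- The vectors of the Fourier basis of `L²(𝕋; ℂᵐ)`, indexed by `ℤ`. -/
def fourierVecLp (m : ℕ) [NeZero m] (j : ℤ) :
    Lp (EuclideanSpace ℂ (Fin m)) 2 (volume : Measure Torus) :=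
  ContinuousMap.toLp 2 volume ℂ (fourierVec m j)

theorem coeFn_fourierVecLp (j : ℤ) :
    (fourierVecLp m j : Torus → EuclideanSpace ℂ (Fin m)) =ᵐ[volume] fourierVec m j :=
  ContinuousMap.coeFn_toLp (p := 2) (𝕜 := ℂ) volume (fourierVec m j)

theorem fourierVec_apply (j : ℤ) (x : Torus) (i : Fin m) :
    fourierVec m j x i = ((√(2 * Real.pi))⁻¹ : ℂ) * blochKernel m x (i : ℕ) j := by
  rw [← blochExt_eq_blochKernel, blochExt_coe]
  simp [fourierVec, Pi.single_apply]

/-- `fourierCoeff` integrates against the Haar probability measure, whereas the inner product uses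
`volume`, of mass `2π`; with the normalization `(√(2π))⁻¹` the factor `√(2π)` remains. -/
theorem inner_fourierVecLp (j : ℤ) (f : Lp (EuclideanSpace ℂ (Fin m)) 2 (volume : Measure Torus)) :
    ⟪fourierVecLp m j, f⟫_ℂ
      = (√(2 * Real.pi) : ℂ) * fourierCoeff (fun x => f x (cell m j)) (j / m) := by
  have h1 : ⟪fourierVecLp m j, f⟫_ℂ = ∫ x : Torus, ((√(2 * Real.pi))⁻¹ : ℂ) *
      (fourier (-(j / m)) x * f x (cell m j)) := by
    rw [L2.inner_def]
    refine integral_congr_ae ?_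
    filter_upwards [coeFn_fourierVecLp (m := m) j] with x hx
    rw [hx]
    simp only [fourierVec, ContinuousMap.coe_mk, inner_smul_left, EuclideanSpace.inner_single_left,
      map_one, one_mul, fourier_neg]
    rw [map_inv₀, Complex.conj_ofReal]
  have hpos : (0 : ℝ) < 2 * Real.pi := Real.two_pi_pos
  have hs : (√(2 * Real.pi) : ℂ) * (√(2 * Real.pi) : ℂ) = (2 * Real.pi : ℝ) := by
    rw [← Complex.ofReal_mul, Real.mul_self_sqrt hpos.le]
  have hs0 : (√(2 * Real.pi) : ℂ) ≠ 0 := by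
    rw [Complex.ofReal_ne_zero]; positivity
  have hp0 : ((2 * Real.pi : ℝ) : ℂ) ≠ 0 := by
    rw [Complex.ofReal_ne_zero]; positivity
  rw [h1, integral_const_mul, fourierCoeff, AddCircle.integral_haarAddCircle, Complex.real_smul,
    Complex.ofReal_inv, ← hs]
  simp only [smul_eq_mul]
  field_simp

/-- Division with remainder makes `j ↦ (cell m j, j / m)` injective, so distinct indices differ in
the component or in the frequency. -/
theorem orthonormal_fourierVecLp : Orthonormal ℂ (fourierVecLp m) := by
  rw [orthonormal_iff_ite]
  intro i j
  rw [inner_fourierVecLp]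
  have hs0 : (√(2 * Real.pi) : ℂ) ≠ 0 := by
    have := Real.two_pi_pos
    rw [Complex.ofReal_ne_zero]; positivity
  have hae : (fun x => fourierVecLp m j x (cell m i)) =ᵐ[AddCircle.haarAddCircle]
      (if cell m i = cell m j then ((√(2 * Real.pi))⁻¹ : ℂ) else 0) • ⇑(fourier (j / m)) := by
    have hac : AddCircle.haarAddCircle ≪ (volume : Measure Torus) := by
      rw [AddCircle.volume_eq_smul_haarAddCircle]
      exact Measure.AbsolutelyContinuous.rfl.smul_right (by simp [Real.pi_pos])
    filter_upwards [hac.ae_le (coeFn_fourierVecLp (m := m) j)] with x hx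
    rw [hx]
    by_cases h : cell m i = cell m j <;> simp [fourierVec, h]
  rw [fourierCoeff_congr_ae hae, fourierCoeff.const_smul, fourierCoeff_fourier]
  by_cases h : i = j
  · subst h
    simp only [if_true, Pi.single_eq_same, smul_eq_mul, mul_one]
    exact mul_inv_cancel₀ hs0
  · rw [if_neg h]
    by_cases hc : cell m i = cell m j
    · have hd : i / (m : ℤ) ≠ j / m := by
        intro hd
        apply h
        rw [← Int.emod_add_mul_ediv i m, ← Int.emod_add_mul_ediv j m, hd, ← coe_cell, ← coe_cell,
          hc]
      simp [hd]
    · simp [hc]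

theorem span_fourierVecLp_orthogonal :
    (Submodule.span ℂ (Set.range (fourierVecLp m)))ᗮ = ⊥ := by
  rw [eq_bot_iff]
  intro f hf
  rw [Submodule.mem_bot]
  have h0 : ∀ j, ⟪fourierVecLp m j, f⟫_ℂ = 0 := fun j =>
    (Submodule.mem_orthogonal _ _).1 hf _ (Submodule.subset_span ⟨j, rfl⟩)
  have hs0 : (√(2 * Real.pi) : ℂ) ≠ 0 := by
    have := Real.two_pi_pos
    rw [Complex.ofReal_ne_zero]; positivity
  have hcomp : ∀ l : Fin m, (fun x => f x l) =ᵐ[volume] 0 := by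
    intro l
    have hL : MemLp (fun x => f x l) 2 (volume : Measure Torus) :=
      (EuclideanSpace.proj (𝕜 := ℂ) l).comp_memLp' (Lp.memLp f)
    have hL' : MemLp (fun x => f x l) 2 (AddCircle.haarAddCircle : Measure Torus) :=
      hL.haarAddCircle
    have hz : hL'.toLp = 0 := by
      apply fourierBasis.repr.injective
      rw [map_zero]
      ext k
      rw [fourierBasis_repr, fourierCoeff_congr_ae hL'.coeFn_toLp]
      have := h0 ((l : ℕ) + k * m)
      have hc : cell m ((l : ℕ) + k * m) = l := by
        rw [← cell_coe l, cell_eq_cell_iff]; simp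
      have hd : (((l : ℕ) : ℤ) + k * m) / m = k := by
        rw [Int.add_mul_ediv_right _ _ (natCast_pos_int (m := m)).ne',
          Int.ediv_eq_zero_of_lt (by positivity) (by exact_mod_cast l.2), zero_add]
      rw [inner_fourierVecLp, hc, hd] at this
      exact (mul_eq_zero.1 this).resolve_left hs0
    have hz' : (fun x => f x l) =ᵐ[(AddCircle.haarAddCircle : Measure Torus)] 0 := by
      have h2 := hL'.coeFn_toLp
      rw [hz] at h2
      exact h2.symm.trans (Lp.coeFn_zero _ _ _)
    have hac : (volume : Measure Torus) ≪ AddCircle.haarAddCircle := by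
      rw [AddCircle.volume_eq_smul_haarAddCircle]
      exact Measure.smul_absolutelyContinuous
    exact hac.ae_le hz'
  apply Lp.ext
  filter_upwards [ae_all_iff.2 hcomp, Lp.coeFn_zero (EuclideanSpace ℂ (Fin m)) 2
    (volume : Measure Torus)] with x hx h0
  rw [h0]
  ext l
  exact hx l

variable (m) in
/-- The Fourier basis of `L²(𝕋; ℂᵐ)`, indexed by `ℤ`. -/
def fourierVecBasis : HilbertBasis ℤ ℂ (Lp (EuclideanSpace ℂ (Fin m)) 2 (volume : Measure Torus)) :=
  HilbertBasis.mkOfOrthogonalEqBot orthonormal_fourierVecLp span_fourierVecLp_orthogonal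

variable (m) in
/-- The Bloch transform `l²(ℤ) ≃ L²(𝕋; ℂᵐ)`. -/
def blochTransform : L2Z ≃ₗᵢ[ℂ] Lp (EuclideanSpace ℂ (Fin m)) 2 (volume : Measure Torus) :=
  (fourierVecBasis m).repr.symm

theorem blochTransform_single (j : ℤ) :
    blochTransform m (lp.single 2 j (1 : ℂ)) = fourierVecLp m j := by
  rw [blochTransform, HilbertBasis.repr_symm_single, fourierVecBasis,
    HilbertBasis.coe_mkOfOrthogonalEqBot]

end FourierBasis

/-! ### Multiplication operators -/

section Multiplication

variable {m : ℕ}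

theorem inner_toEuclideanLin_unitary {Q : Matrix (Fin m) (Fin m) ℂ}
    (hQ : Q ∈ Matrix.unitaryGroup (Fin m) ℂ) (v w : EuclideanSpace ℂ (Fin m)) :
    ⟪Matrix.toEuclideanLin Q v, Matrix.toEuclideanLin Q w⟫_ℂ = ⟪v, w⟫_ℂ := by
  rw [← LinearMap.adjoint_inner_right, ← Matrix.toEuclideanLin_conjTranspose_eq_adjoint]
  congr 1
  ext1
  simp only [Matrix.ofLp_toLpLin, Matrix.toLin'_apply]
  rw [Matrix.mulVec_mulVec, ← Matrix.star_eq_conjTranspose, Matrix.mem_unitaryGroup_iff'.1 hQ, Matrix.one_mulVec]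

theorem norm_toEuclideanLin {Q : Matrix (Fin m) (Fin m) ℂ} (hQ : Q ∈ Matrix.unitaryGroup (Fin m) ℂ)
    (v : EuclideanSpace ℂ (Fin m)) : ‖Matrix.toEuclideanLin Q v‖ = ‖v‖ := by
  rw [@norm_eq_sqrt_re_inner ℂ, @norm_eq_sqrt_re_inner ℂ, inner_toEuclideanLin_unitary hQ]

theorem continuous_toEuclideanLin {T : Torus → Matrix (Fin m) (Fin m) ℂ} (hT : Continuous T) :
    Continuous fun p : Torus × EuclideanSpace ℂ (Fin m) => Matrix.toEuclideanLin (T p.1) p.2 := by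
  simp only [Matrix.toLpLin_apply]
  refine (PiLp.continuous_toLp 2 _).comp ?_
  exact (hT.comp continuous_fst).matrix_mulVec ((PiLp.continuous_ofLp 2 _).comp continuous_snd)

theorem memLp_toEuclideanLin {T : Torus → Matrix (Fin m) (Fin m) ℂ} (hT : Continuous T)
    (hU : ∀ x, T x ∈ Matrix.unitaryGroup (Fin m) ℂ) {f : Torus → EuclideanSpace ℂ (Fin m)}
    (hf : MemLp f 2 volume) :
    MemLp (fun x => Matrix.toEuclideanLin (T x) (f x)) 2 volume := by
  have hm : AEStronglyMeasurable (fun x => Matrix.toEuclideanLin (T x) (f x)) volume :=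
    (continuous_toEuclideanLin hT).comp_aestronglyMeasurable
      (f := fun x => (x, f x)) (continuous_id.aestronglyMeasurable.prodMk hf.1)
  exact MemLp.of_le hf hm (Filter.Eventually.of_forall fun x => (norm_toEuclideanLin (hU x) _).le)

/-- The operator of multiplication by a continuous unitary matrix function. -/
def mulOp {T : Torus → Matrix (Fin m) (Fin m) ℂ} (hT : Continuous T)
    (hU : ∀ x, T x ∈ Matrix.unitaryGroup (Fin m) ℂ) :
    Lp (EuclideanSpace ℂ (Fin m)) 2 (volume : Measure Torus) →ₗᵢ[ℂ]
      Lp (EuclideanSpace ℂ (Fin m)) 2 (volume : Measure Torus) where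
  toFun f := (memLp_toEuclideanLin hT hU (Lp.memLp f)).toLp
  map_add' f g := by
    rw [← MemLp.toLp_add]
    refine MemLp.toLp_congr _ _ ?_
    filter_upwards [Lp.coeFn_add f g] with x hx
    rw [hx, Pi.add_apply, Pi.add_apply, map_add]
  map_smul' c f := by
    rw [RingHom.id_apply, ← MemLp.toLp_const_smul]
    refine MemLp.toLp_congr _ _ ?_
    filter_upwards [Lp.coeFn_smul c f] with x hx
    rw [hx, Pi.smul_apply, Pi.smul_apply, map_smul]
  norm_map' f := by
    have h := (memLp_toEuclideanLin hT hU (Lp.memLp f)).coeFn_toLp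
    apply le_antisymm <;> refine Lp.norm_le_norm_of_ae_le ?_ <;> filter_upwards [h] with x hx
    · exact (congrArg norm hx).trans (norm_toEuclideanLin (hU x) _) |>.le
    · exact (congrArg norm hx).trans (norm_toEuclideanLin (hU x) _) |>.ge

theorem coeFn_mulOp {T : Torus → Matrix (Fin m) (Fin m) ℂ} (hT : Continuous T)
    (hU : ∀ x, T x ∈ Matrix.unitaryGroup (Fin m) ℂ)
    (f : Lp (EuclideanSpace ℂ (Fin m)) 2 (volume : Measure Torus)) :
    (mulOp hT hU f : Torus → EuclideanSpace ℂ (Fin m)) =ᵐ[volume]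
      fun x => Matrix.toEuclideanLin (T x) (f x) :=
  (memLp_toEuclideanLin hT hU (Lp.memLp f)).coeFn_toLp

/-! ### The Bloch transform of a block diagonal operator -/

theorem blockFun_single {p : ℤ} (S : ℤ → Matrix (Fin 2) (Fin 2) ℂ) {j : ℤ} (h : Even (j - p)) :
    blockFun p S (Pi.single j 1) = S j 0 0 • Pi.single j 1 + S j 1 0 • Pi.single (j + 1) 1 := by
  funext i
  rcases even_or_eq_succ p i with hi | ⟨i, hi, rfl⟩
  · have h1 : i + 1 ≠ j := by
      rintro rfl
      rw [show i + 1 - p = i - p + 1 by ring, Int.even_add_one] at h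
      exact h hi
    have h2 : i ≠ j + 1 := by
      rintro rfl
      rw [show j + 1 - p = j - p + 1 by ring, Int.even_add_one] at hi
      exact hi h
    rw [blockFun_even hi]
    by_cases hij : i = j
    · subst hij; simp
    · simp [h1, h2, hij]
  · have h1 : i + 1 ≠ j := by
      rintro rfl
      rw [show i + 1 - p = i - p + 1 by ring, Int.even_add_one] at h
      exact h hi
    rw [blockFun_even_succ hi]
    by_cases hij : i = j
    · subst hij; simp
    · simp [h1, hij]

theorem blockFun_single_succ {p : ℤ} (S : ℤ → Matrix (Fin 2) (Fin 2) ℂ) {j : ℤ}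
    (h : Even (j - p)) :
    blockFun p S (Pi.single (j + 1) 1)
      = S j 0 1 • Pi.single j 1 + S j 1 1 • Pi.single (j + 1) 1 := by
  funext i
  rcases even_or_eq_succ p i with hi | ⟨i, hi, rfl⟩
  · have h2 : i ≠ j + 1 := by
      rintro rfl
      rw [show j + 1 - p = j - p + 1 by ring, Int.even_add_one] at hi
      exact hi h
    rw [blockFun_even hi]
    by_cases hij : i = j
    · subst hij; simp
    · simp [h2, hij]
  · have h1 : i + 1 ≠ j := by
      rintro rfl
      rw [show i + 1 - p = i - p + 1 by ring, Int.even_add_one] at h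
      exact h hi
    have h2 : i ≠ j + 1 := by
      rintro rfl
      rw [show j + 1 - p = j - p + 1 by ring, Int.even_add_one] at hi
      exact hi h
    rw [blockFun_even_succ hi]
    by_cases hij : i = j
    · subst hij; simp
    · simp [h1, h2, hij]

/-- Commutation with the kernel moves the operator from the first variable to the second, so the
coefficients become those at `j`, independent of `i` and `x`, as required for the image of a basis
vector. -/
theorem blockFun_blochKernel (hm : Even m) {p : ℤ} {S : ℤ → Matrix (Fin 2) (Fin 2) ℂ}
    (hS : ∀ k, S (k + m) = S k) (x : Torus) {j : ℤ} (h : Even (j - p)) (i : ℤ) :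
    blockFun p S (fun i => blochKernel m x i j) i
      = S j 0 0 * blochKernel m x i j + S j 1 0 * blochKernel m x i (j + 1) := by
  have := conj_blockFun_blochKernel hm p (S := fun k => (S k).conjTranspose)
    (fun k => by rw [hS]) x i j
  simp only [Matrix.conjTranspose_conjTranspose] at this
  rw [← this, blockFun_even h]
  simp [conj_blochKernel]

theorem blockFun_blochKernel_succ (hm : Even m) {p : ℤ} {S : ℤ → Matrix (Fin 2) (Fin 2) ℂ}
    (hS : ∀ k, S (k + m) = S k) (x : Torus) {j : ℤ} (h : Even (j - p)) (i : ℤ) :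
    blockFun p S (fun i => blochKernel m x i (j + 1)) i
      = S j 0 1 * blochKernel m x i j + S j 1 1 * blochKernel m x i (j + 1) := by
  have := conj_blockFun_blochKernel hm p (S := fun k => (S k).conjTranspose)
    (fun k => by rw [hS]) x i (j + 1)
  simp only [Matrix.conjTranspose_conjTranspose] at this
  rw [← this, blockFun_even_succ h]
  simp [conj_blochKernel]

variable [NeZero m]

theorem continuous_symbol (p : ℤ) (S : ℤ → Matrix (Fin 2) (Fin 2) ℂ) :
    Continuous (symbol m p S) := by
  refine continuous_matrix fun i l => ?_
  have h : ∀ j k : ℤ, Continuous fun x => blochKernel m x j k := by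
    intro j k
    unfold blochKernel
    split_ifs
    · exact map_continuous _
    · exact continuous_const
  simp only [symbol_apply, blockFun]
  split_ifs <;> exact ((h _ _).const_mul _).add ((h _ _).const_mul _)

theorem toEuclideanLin_symbol_fourierVec (p : ℤ) (S : ℤ → Matrix (Fin 2) (Fin 2) ℂ) (x : Torus)
    (j : ℤ) (i : Fin m) :
    Matrix.toEuclideanLin (symbol m p S x) (fourierVec m j x) i
      = ((√(2 * Real.pi))⁻¹ : ℂ) * blockFun p S (fun i => blochKernel m x i j) (i : ℕ) := by
  rw [Matrix.ofLp_toLpLin, Matrix.toLin'_apply, symbol_mulVec]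
  have h : blochExt m x (fourierVec m j x).ofLp
      = ((√(2 * Real.pi))⁻¹ : ℂ) • fun i => blochKernel m x i j := by
    funext k
    rw [Pi.smul_apply, ← blochExt_eq_blochKernel, ← Pi.smul_apply (M := fun _ => ℂ), ← map_smul]
    simp [fourierVec]
  rw [h]
  exact congrFun ((blockLin p S).map_smul _ _) _

theorem mulOp_symbol_fourierVecLp (hm : Even m) {p : ℤ} {S : ℤ → Matrix (Fin 2) (Fin 2) ℂ}
    (hS : ∀ k, S (k + m) = S k) (hU : ∀ x, symbol m p S x ∈ Matrix.unitaryGroup (Fin m) ℂ)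
    {j : ℤ} (h : Even (j - p)) :
    mulOp (continuous_symbol p S) hU (fourierVecLp m j)
      = S j 0 0 • fourierVecLp m j + S j 1 0 • fourierVecLp m (j + 1) := by
  apply Lp.ext
  filter_upwards [coeFn_mulOp (continuous_symbol p S) hU (fourierVecLp m j),
    coeFn_fourierVecLp (m := m) j, coeFn_fourierVecLp (m := m) (j + 1),
    Lp.coeFn_add (S j 0 0 • fourierVecLp m j) (S j 1 0 • fourierVecLp m (j + 1)),
    Lp.coeFn_smul (S j 0 0) (fourierVecLp m j), Lp.coeFn_smul (S j 1 0) (fourierVecLp m (j + 1))]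
    with x h1 h2 h3 h4 h5 h6
  rw [h1, h4, Pi.add_apply, h5, h6, Pi.smul_apply, Pi.smul_apply, h2, h3]
  ext i
  rw [toEuclideanLin_symbol_fourierVec, blockFun_blochKernel hm hS x h]
  simp only [PiLp.add_apply, PiLp.smul_apply, fourierVec_apply, smul_eq_mul]
  ring

theorem mulOp_symbol_fourierVecLp_succ (hm : Even m) {p : ℤ} {S : ℤ → Matrix (Fin 2) (Fin 2) ℂ}
    (hS : ∀ k, S (k + m) = S k) (hU : ∀ x, symbol m p S x ∈ Matrix.unitaryGroup (Fin m) ℂ)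
    {j : ℤ} (h : Even (j - p)) :
    mulOp (continuous_symbol p S) hU (fourierVecLp m (j + 1))
      = S j 0 1 • fourierVecLp m j + S j 1 1 • fourierVecLp m (j + 1) := by
  apply Lp.ext
  filter_upwards [coeFn_mulOp (continuous_symbol p S) hU (fourierVecLp m (j + 1)),
    coeFn_fourierVecLp (m := m) j, coeFn_fourierVecLp (m := m) (j + 1),
    Lp.coeFn_add (S j 0 1 • fourierVecLp m j) (S j 1 1 • fourierVecLp m (j + 1)),
    Lp.coeFn_smul (S j 0 1) (fourierVecLp m j), Lp.coeFn_smul (S j 1 1) (fourierVecLp m (j + 1))]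
    with x h1 h2 h3 h4 h5 h6
  rw [h1, h4, Pi.add_apply, h5, h6, Pi.smul_apply, Pi.smul_apply, h2, h3]
  ext i
  rw [toEuclideanLin_symbol_fourierVec, blockFun_blochKernel_succ hm hS x h]
  simp only [PiLp.add_apply, PiLp.smul_apply, fourierVec_apply, smul_eq_mul]
  ring

theorem ext_lp_single {F : Type*} [NormedAddCommGroup F] [NormedSpace ℂ F] {A B : L2Z →L[ℂ] F}
    (h : ∀ j, A (lp.single 2 j (1 : ℂ)) = B (lp.single 2 j (1 : ℂ))) : A = B := by
  ext f
  have hf := lp.hasSum_single (p := 2) (by norm_num) f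
  have hs : ∀ j, lp.single 2 j (f j) = f j • (lp.single 2 j (1 : ℂ) : L2Z) := by
    intro j
    rw [← lp.single_smul, smul_eq_mul, mul_one]
  refine (hf.mapL A).unique ?_
  convert hf.mapL B using 2 with j
  rw [hs, map_smul, map_smul, h]

/-- The Bloch transform turns a periodic block diagonal operator into multiplication by its
symbol. -/
theorem blochTransform_blockOp (hm : Even m) (p : ℤ) (S : ℤ → Matrix.unitaryGroup (Fin 2) ℂ)
    (hS : ∀ k, S (k + m) = S k)
    (hU : ∀ x, symbol m p (fun k => (S k).1) x ∈ Matrix.unitaryGroup (Fin m) ℂ) (f : L2Z) :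
    blochTransform m (blockOp p S f)
      = mulOp (continuous_symbol p (fun k => (S k).1)) hU (blochTransform m f) := by
  have hS' : ∀ k, (fun k => (S k).1) (k + m) = (S k).1 := fun k => congrArg Subtype.val (hS k)
  have key : ((blochTransform m).toContinuousLinearEquiv.toContinuousLinearMap ∘L
        (blockOp p S).toContinuousLinearEquiv.toContinuousLinearMap)
      = (mulOp (continuous_symbol p (fun k => (S k).1)) hU).toContinuousLinearMap ∘L
        (blochTransform m).toContinuousLinearEquiv.toContinuousLinearMap := by
    refine ext_lp_single fun j => ?_
    change blochTransform m (blockOp p S (lp.single 2 j 1)) =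
      mulOp (continuous_symbol p (fun k => (S k).1)) hU (blochTransform m _)
    rw [blochTransform_single]
    rcases even_or_eq_succ p j with h | ⟨j, h, rfl⟩
    · rw [mulOp_symbol_fourierVecLp hm hS' hU h]
      have : blockOp p S (lp.single 2 j 1) = (S j).1 0 0 • (lp.single 2 j (1 : ℂ) : L2Z)
          + (S j).1 1 0 • (lp.single 2 (j + 1) (1 : ℂ) : L2Z) :=
        lp.ext (blockFun_single (fun k => (S k).1) h)
      rw [this, map_add, map_smul, map_smul, blochTransform_single, blochTransform_single]
    · rw [mulOp_symbol_fourierVecLp_succ hm hS' hU h]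
      have : blockOp p S (lp.single 2 (j + 1) 1) = (S j).1 0 1 • (lp.single 2 j (1 : ℂ) : L2Z)
          + (S j).1 1 1 • (lp.single 2 (j + 1) (1 : ℂ) : L2Z) :=
        lp.ext (blockFun_single_succ (fun k => (S k).1) h)
      rw [this, map_add, map_smul, map_smul, blochTransform_single, blochTransform_single]
  exact congrArg (fun A => A f) key

end Multiplication

/-! ### Spectral measures of unitary matrices -/

section UnitaryMatrix

variable {m : ℕ} {Q : Matrix (Fin m) (Fin m) ℂ}

/-- Unitarity gives `⟪v, w⟫ = c̄ d ⟪v, w⟫` with `|c| = 1`; a nonzero product would force `c̄ d = 1`,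
hence `c = d`. -/
theorem eigenspace_orthogonal (hQ : Q ∈ Matrix.unitaryGroup (Fin m) ℂ) {c d : ℂ} (hcd : c ≠ d)
    {v w : EuclideanSpace ℂ (Fin m)} (hv : Matrix.toEuclideanLin Q v = c • v)
    (hw : Matrix.toEuclideanLin Q w = d • w) : ⟪v, w⟫_ℂ = 0 := by
  by_cases hv0 : v = 0
  · simp [hv0]
  have h1 := inner_toEuclideanLin_unitary hQ v w
  have h2 := norm_toEuclideanLin hQ v
  rw [hv, norm_smul, mul_eq_right₀ (norm_ne_zero_iff.2 hv0)] at h2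
  rw [hv, hw, inner_smul_left, inner_smul_right] at h1
  have h3 : (starRingEnd ℂ) c * c = 1 := by
    rw [← Complex.normSq_eq_conj_mul_self, Complex.normSq_eq_norm_sq, h2]; simp
  by_contra h0
  apply hcd
  have h4 : (starRingEnd ℂ) c * d = 1 := by
    rw [← mul_assoc] at h1
    exact (mul_eq_right₀ h0).1 h1
  calc c = c * ((starRingEnd ℂ) c * d) := by rw [h4, mul_one]
    _ = ((starRingEnd ℂ) c * c) * d := by ring
    _ = d := by rw [h3, one_mul]

theorem exists_orthonormalBasis_eigenvectors (hQ : Q ∈ Matrix.unitaryGroup (Fin m) ℂ) :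
    ∃ (b : OrthonormalBasis (Fin m) ℂ (EuclideanSpace ℂ (Fin m))) (y : Fin m → Torus),
      ∀ i, Matrix.toEuclideanLin Q (b i) = (fourier 1 (y i) : ℂ) • b i := by
  set L := Matrix.toEuclideanLin Q with hL
  have hort : OrthogonalFamily ℂ (fun c : Module.End.Eigenvalues L => Module.End.eigenspace L c)
      fun c => (Module.End.eigenspace L c).subtypeₗᵢ := by
    intro c d hcd v w
    exact eigenspace_orthogonal hQ (fun h => hcd (Subtype.ext h))
      (Module.End.mem_eigenspace_iff.1 v.2) (Module.End.mem_eigenspace_iff.1 w.2)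
  have hbot : (⨆ c : Module.End.Eigenvalues L, Module.End.eigenspace L c)ᗮ = ⊥ := by
    set K := (⨆ c : Module.End.Eigenvalues L, Module.End.eigenspace L c)ᗮ with hK
    have hmem : ∀ {u w : EuclideanSpace ℂ (Fin m)} {c : ℂ}, L u = c • u → u ≠ 0 → w ∈ K →
        ⟪u, w⟫_ℂ = 0 := by
      intro u w c hu hu0 hw
      have hc : Module.End.HasEigenvalue L c :=
        Module.End.hasEigenvalue_of_hasEigenvector ⟨Module.End.mem_eigenspace_iff.2 hu, hu0⟩
      exact (Submodule.mem_orthogonal _ _).1 hw u (Submodule.mem_iSup_of_mem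
        (⟨c, hc⟩ : Module.End.Eigenvalues L) (Module.End.mem_eigenspace_iff.2 hu))
    -- If `L u = c u` and `w ∈ K`, then `c̄ ⟪u, L w⟫ = ⟪L u, L w⟫ = ⟪u, w⟫ = 0`, and `c ≠ 0` for `u
    -- ≠ 0`. A nonzero `K` would then contain an eigenvector, which would be orthogonal to itself.
    have hinv : ∀ w ∈ K, L w ∈ K := by
      intro w hw
      rw [hK, ← Submodule.iInf_orthogonal, Submodule.mem_iInf]
      intro c
      rw [Submodule.mem_orthogonal]
      intro u hu
      rw [Module.End.mem_eigenspace_iff] at hu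
      by_cases hu0 : u = 0
      · simp [hu0]
      have h1 : ⟪L u, L w⟫_ℂ = ⟪u, w⟫_ℂ := inner_toEuclideanLin_unitary hQ u w
      rw [hmem hu hu0 hw, hu, inner_smul_left] at h1
      refine (mul_eq_zero.1 h1).resolve_left fun hc => ?_
      have hc0 : (c : ℂ) = 0 := by simpa using hc
      have h2 := norm_toEuclideanLin hQ u
      rw [← hL, hu, hc0, zero_smul, norm_zero] at h2
      exact hu0 (norm_eq_zero.1 h2.symm)
    by_contra hne
    have : Nontrivial K := Submodule.nontrivial_iff_ne_bot.2 hne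
    obtain ⟨c, hc⟩ := Module.End.exists_eigenvalue (L.restrict hinv)
    obtain ⟨w, hw⟩ := hc.exists_hasEigenvector
    have hw1 : L w = c • (w : EuclideanSpace ℂ (Fin m)) :=
      congrArg Subtype.val hw.apply_eq_smul
    have hw0 : (w : EuclideanSpace ℂ (Fin m)) ≠ 0 := fun h => hw.2 (Subtype.ext h)
    exact hw0 (inner_self_eq_zero.1 (hmem hw1 hw0 w.2))
  have hint : DirectSum.IsInternal
      (fun c : Module.End.Eigenvalues L => Module.End.eigenspace L c) :=
    hort.isInternal_iff.2 hbot
  have hfin : Module.finrank ℂ (EuclideanSpace ℂ (Fin m)) = m := finrank_euclideanSpace_fin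
  let b := hint.subordinateOrthonormalBasis hfin hort
  have hb : ∀ i, ∃ c : ℂ, L (b i) = c • b i := fun i =>
    ⟨_, Module.End.mem_eigenspace_iff.1 (hint.subordinateOrthonormalBasis_subordinate hfin i hort)⟩
  have hy : ∀ i, ∃ y : Torus, L (b i) = (fourier 1 y : ℂ) • b i := by
    intro i
    obtain ⟨c, hc⟩ := hb i
    have h2 := norm_toEuclideanLin hQ (b i)
    rw [← hL, hc, norm_smul, b.norm_eq_one, mul_one] at h2
    obtain ⟨y, hy⟩ := (AddCircle.homeomorphCircle (T := 2 * Real.pi)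
      Real.two_pi_pos.ne').surjective ⟨c, mem_sphere_zero_iff_norm.2 h2⟩
    refine ⟨y, ?_⟩
    rw [hc, fourier_one, ← AddCircle.homeomorphCircle_apply Real.two_pi_pos.ne', hy]
  choose y hy using hy
  exact ⟨b, y, hy⟩

theorem toEuclideanLin_pow_apply (Q : Matrix (Fin m) (Fin m) ℂ) {v : EuclideanSpace ℂ (Fin m)}
    {c : ℂ} (h : Matrix.toEuclideanLin Q v = c • v) (n : ℕ) :
    Matrix.toEuclideanLin (Q ^ n) v = c ^ n • v := by
  induction n with
  | zero => simp
  | succ n ih =>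
    have : Matrix.toEuclideanLin (Q ^ (n + 1)) v
        = Matrix.toEuclideanLin (Q ^ n) (Matrix.toEuclideanLin Q v) := by
      simp [pow_succ]
    rw [this, h, map_smul, ih, smul_smul, pow_succ, mul_comm]

/-- The measure is the sum of point masses at the eigenvalue angles, weighted by `‖⟪b i, v⟫‖²`.
Being atomic, it vanishes on every set without eigenvalues, measurable or not. -/
theorem exists_spectralMeasure_matrix (hQ : Q ∈ Matrix.unitaryGroup (Fin m) ℂ)
    (v : EuclideanSpace ℂ (Fin m)) :
    ∃ ν : Measure Torus, IsFiniteMeasure ν ∧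
      (∀ n : ℕ, ∫ y, fourier n y ∂ν = ⟪v, Matrix.toEuclideanLin (Q ^ n) v⟫_ℂ) ∧
      ∀ A : Set Torus, (∀ y ∈ A, ¬ Module.End.HasEigenvalue (Matrix.toLin' Q) (fourier 1 y)) →
        ν A = 0 := by
  obtain ⟨b, y, hb⟩ := exists_orthonormalBasis_eigenvectors hQ
  refine ⟨∑ i, ENNReal.ofReal (‖⟪b i, v⟫_ℂ‖ ^ 2) • Measure.dirac (y i), ?_, fun n => ?_,
    fun A hA => ?_⟩
  · refine ⟨?_⟩
    rw [Measure.finsetSum_apply]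
    exact ENNReal.sum_lt_top.2 fun i _ => by simp
  · rw [integral_finsetSum_measure fun i _ => ?_]
    · have hv : Matrix.toEuclideanLin (Q ^ n) v
          = ∑ i, ⟪b i, v⟫_ℂ • ((fourier 1 (y i) : ℂ) ^ n • b i) := by
        conv_lhs => rw [← b.sum_repr' v]
        rw [map_sum]
        exact Finset.sum_congr rfl fun i _ => by
          rw [map_smul, toEuclideanLin_pow_apply Q (hb i)]
      rw [hv, inner_sum]
      refine Finset.sum_congr rfl fun i _ => ?_
      rw [integral_smul_measure, integral_dirac, inner_smul_right, inner_smul_right,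
        ENNReal.toReal_ofReal (by positivity), Complex.real_smul,
        ← inner_conj_symm v, mul_left_comm, mul_comm (⟪b i, v⟫_ℂ),
        ← Complex.normSq_eq_conj_mul_self, Complex.normSq_eq_norm_sq, mul_comm]
      congr 1
      rw [fourier_apply, fourier_apply, one_zsmul, AddCircle.toCircle_zsmul]
      simp
    · exact (Continuous.integrable_of_hasCompactSupport (map_continuous _)
        (HasCompactSupport.of_compactSpace _)).smul_measure (by simp)
  · rw [Measure.finsetSum_apply, Finset.sum_eq_zero]
    intro i _
    rw [Measure.smul_apply, smul_eq_mul, mul_eq_zero]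
    right
    have : y i ∉ A := fun hi => hA _ hi <| by
      refine Module.End.hasEigenvalue_of_hasEigenvector (x := (b i).ofLp)
        ⟨Module.End.mem_eigenspace_iff.2 ?_, ?_⟩
      · have := congrArg WithLp.ofLp (hb i)
        rwa [Matrix.ofLp_toLpLin] at this
      · intro h0
        have : b i = 0 := by ext i; exact congrFun h0 i
        have h1 := b.norm_eq_one i
        rw [this, norm_zero] at h1
        exact zero_ne_one h1
    rw [Measure.dirac_apply]
    simp [this]

end UnitaryMatrix

/-! ### Measurability of families of measures on the torus -/

theorem integrable_continuousMap (μ : Measure Torus) [IsFiniteMeasure μ] (g : C(Torus, ℂ)) :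
    Integrable g μ :=
  (map_continuous g).integrable_of_hasCompactSupport (HasCompactSupport.of_compactSpace _)

/-- Trigonometric polynomials are uniformly dense, and uniform convergence passes through integrals
against finite measures; measurability survives pointwise limits in `x`. -/
theorem measurable_integral_of_fourier {Ω : Type*} [MeasurableSpace Ω] {ν : Ω → Measure Torus}
    [∀ x, IsFiniteMeasure (ν x)] (h : ∀ n : ℤ, Measurable fun x => ∫ y, fourier n y ∂ν x)
    (g : C(Torus, ℂ)) : Measurable fun x => ∫ y, g y ∂ν x := by
  have hspan : ∀ g ∈ Submodule.span ℂ (Set.range (fourier (T := 2 * Real.pi))),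
      Measurable fun x => ∫ y, g y ∂ν x := by
    intro g hg
    induction hg using Submodule.span_induction with
    | mem g hg => obtain ⟨n, rfl⟩ := hg; exact h n
    | zero => simp
    | add g₁ g₂ _ _ h₁ h₂ =>
      have : (fun x => ∫ y, (g₁ + g₂) y ∂ν x) = fun x => ∫ y, g₁ y ∂ν x + ∫ y, g₂ y ∂ν x :=
        funext fun x => integral_add (integrable_continuousMap _ _) (integrable_continuousMap _ _)
      rw [this]
      exact h₁.add h₂
    | smul c g _ hg =>
      have : (fun x => ∫ y, (c • g) y ∂ν x) = fun x => c * ∫ y, g y ∂ν x :=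
        funext fun x => integral_const_mul c _
      rw [this]
      exact hg.const_mul c
  have hg : g ∈ closure (Submodule.span ℂ (Set.range (fourier (T := 2 * Real.pi))) :
      Set C(Torus, ℂ)) := by
    rw [← Submodule.topologicalClosure_coe, span_fourier_closure_eq_top]; trivial
  obtain ⟨u, hu, hlim⟩ := mem_closure_iff_seq_limit.1 hg
  refine measurable_of_tendsto_metrizable (fun k => hspan (u k) (hu k)) ?_
  rw [tendsto_pi_nhds]
  intro x
  rw [tendsto_iff_norm_sub_tendsto_zero]
  have hb : Filter.Tendsto (fun k => ‖u k - g‖ * (ν x).real Set.univ) Filter.atTop (nhds 0) := by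
    simpa using (tendsto_iff_norm_sub_tendsto_zero.1 hlim).mul_const ((ν x).real Set.univ)
  refine squeeze_zero (fun _ => norm_nonneg _) (fun k => ?_) hb
  rw [← integral_sub (integrable_continuousMap _ _) (integrable_continuousMap _ _)]
  exact norm_integral_le_of_norm_le_const (Filter.Eventually.of_forall fun y =>
    (u k - g).norm_coe_le_norm y)

/-- This avoids a measurable choice of eigenvectors: the Fourier coefficients are explicit even when
the measures are chosen pointwise. Closed sets are reached through continuous thickened indicators,
and they form a π-system generating the Borel sets. -/
theorem measurable_of_measurable_fourier {Ω : Type*} [MeasurableSpace Ω] {ν : Ω → Measure Torus}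
    [∀ x, IsFiniteMeasure (ν x)] (h : ∀ n : ℤ, Measurable fun x => ∫ y, fourier n y ∂ν x) :
    Measurable ν := by
  have hclosed : ∀ F : Set Torus, IsClosed F → Measurable fun x => ν x F := by
    intro F hF
    have hδ : ∀ n : ℕ, (0 : ℝ) < 1 / ((n : ℝ) + 1) := fun n => by positivity
    refine measurable_of_tendsto_metrizable (f := fun n x =>
      ∫⁻ y, (thickenedIndicator (hδ n) F y : ℝ≥0∞) ∂ν x) (fun n => ?_)
      (tendsto_pi_nhds.2 fun x => tendsto_lintegral_thickenedIndicator_of_isClosed (ν x) hF hδ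
        tendsto_one_div_add_atTop_nhds_zero_nat)
    let g : C(Torus, ℂ) := ⟨fun y => ((thickenedIndicator (hδ n) F y : ℝ) : ℂ), by fun_prop⟩
    have hg : (fun x => ∫⁻ y, (thickenedIndicator (hδ n) F y : ℝ≥0∞) ∂ν x)
        = fun x => ENNReal.ofReal (∫ y, g y ∂ν x).re := by
      funext x
      have h1 := BoundedContinuousFunction.toReal_lintegral_coe_eq_integral
        (thickenedIndicator (hδ n) F) (ν x)
      have h2 : ∫ y, g y ∂ν x = ((∫ y, (thickenedIndicator (hδ n) F y : ℝ) ∂ν x : ℝ) : ℂ) :=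
        integral_ofReal
      rw [h2, Complex.ofReal_re, ← h1, ENNReal.ofReal_toReal]
      exact (BoundedContinuousFunction.lintegral_lt_top_of_nnreal _ _).ne
    rw [hg]
    exact (Complex.measurable_re.comp (measurable_integral_of_fourier h g)).ennreal_ofReal
  refine Measurable.measure_of_isPiSystem
    (BorelSpace.measurable_eq.trans borel_eq_generateFrom_isClosed) isPiSystem_isClosed
    (fun F hF => hclosed F hF) (hclosed _ isClosed_univ)

theorem integral_fourier_neg (μ : Measure Torus) (n : ℤ) :
    ∫ y, fourier (-n) y ∂μ = (starRingEnd ℂ) (∫ y, fourier n y ∂μ) := by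
  rw [← integral_conj]
  simp only [fourier_neg]

/-! ### Absolute continuity of matrix multiplication operators -/

theorem coeFn_pow_of_mul {H : Type*} [NormedAddCommGroup H] [InnerProductSpace ℂ H]
    {U : H ≃ₗᵢ[ℂ] H} {m : ℕ} {T : Torus → Matrix (Fin m) (Fin m) ℂ}
    {W : H ≃ₗᵢ[ℂ] Lp (EuclideanSpace ℂ (Fin m)) 2 (volume : Measure Torus)}
    (hW : ∀ ψ : H, (W (U ψ) : Torus → EuclideanSpace ℂ (Fin m)) =ᵐ[volume]
      fun x => Matrix.toEuclideanLin (T x) (W ψ x)) (ψ : H) (n : ℕ) :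
    (W ((U ^ n) ψ) : Torus → EuclideanSpace ℂ (Fin m)) =ᵐ[volume]
      fun x => Matrix.toEuclideanLin (T x ^ n) (W ψ x) := by
  induction n with
  | zero =>
    refine Filter.Eventually.of_forall fun x => ?_
    simp
  | succ n ih =>
    have h : (U ^ (n + 1)) ψ = U ((U ^ n) ψ) := by rw [pow_succ']; rfl
    rw [h]
    filter_upwards [hW ((U ^ n) ψ), ih] with x h1 h2
    rw [h1, h2]
    simp [pow_succ']

theorem measurable_toEuclideanLin {m : ℕ} {T : Torus → Matrix (Fin m) (Fin m) ℂ}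
    (hT : Continuous T) {u : Torus → EuclideanSpace ℂ (Fin m)} (hu : Measurable u) :
    Measurable fun x => Matrix.toEuclideanLin (T x) (u x) := by
  have hp : Measurable fun x : Torus => (x, u x) := Measurable.prodMk measurable_id hu
  exact ((continuous_toEuclideanLin hT).comp_stronglyMeasurable hp.stronglyMeasurable).measurable

theorem measurable_inner_pow {m : ℕ} {T : Torus → Matrix (Fin m) (Fin m) ℂ} (hT : Continuous T)
    {u : Torus → EuclideanSpace ℂ (Fin m)} (hu : Measurable u) (n : ℕ) :
    Measurable fun x => ⟪u x, Matrix.toEuclideanLin (T x ^ n) (u x)⟫_ℂ :=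
  hu.inner (measurable_toEuclideanLin (T := fun x => T x ^ n) (hT.pow n) hu)

/-- The spectral measure of `ψ` is `∫ ‖f x‖² ν_x dx`, where `f = W ψ` and `ν_x` is the spectral
measure of `T x` at the normalized vector. A null set is avoided by the spectrum of `T x`, hence has
`ν_x`-measure 0, for almost every `x`. -/
theorem isPurelyAC_of_mul {H : Type*} [NormedAddCommGroup H] [InnerProductSpace ℂ H]
    {U : H ≃ₗᵢ[ℂ] H} {m : ℕ} {T : Torus → Matrix (Fin m) (Fin m) ℂ} (hT : Continuous T)
    (hQ : ∀ x, T x ∈ Matrix.unitaryGroup (Fin m) ℂ) (hE : IsUnitarilyEquivalentToMul U T)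
    (hA : ∀ A : Set Torus, volume A = 0 → ∀ᵐ x : Torus, ∀ y ∈ A,
      ¬ Module.End.HasEigenvalue (Matrix.toLin' (T x)) (fourier 1 y)) :
    IsPurelyAC U := by
  obtain ⟨W, hW⟩ := hE
  intro ψ
  set f := W ψ with hf
  have hfm : Measurable f := (Lp.stronglyMeasurable f).measurable
  -- Normalizing bounds the mass of every `ν x` by 1, so they form a finite kernel; the weight `‖f
  -- x‖²` goes into the base measure. Where `f x = 0`, the convention `0⁻¹ = 0` gives `u x = 0`.
  let u : Torus → EuclideanSpace ℂ (Fin m) := fun x => ((‖f x‖⁻¹ : ℝ) : ℂ) • f x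
  have hum : Measurable u :=
    (Complex.measurable_ofReal.comp hfm.norm.inv).smul hfm
  have hu1 : ∀ x, ‖u x‖ ≤ 1 := by
    intro x
    rw [norm_smul, Complex.norm_real, norm_inv, norm_norm]
    exact inv_mul_le_one
  have huf : ∀ x, (‖f x‖ : ℂ) • u x = f x := by
    intro x
    by_cases h0 : f x = 0
    · simp [u, h0]
    · rw [smul_smul, ← Complex.ofReal_mul, mul_inv_cancel₀ (norm_ne_zero_iff.2 h0),
        Complex.ofReal_one, one_smul]
  choose ν hνf hνn hνA using fun x => exists_spectralMeasure_matrix (hQ x) (u x)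
  have hmom : ∀ n : ℕ, Measurable fun x => ∫ y, fourier n y ∂ν x := by
    intro n
    simp only [hνn]
    exact measurable_inner_pow hT hum n
  have hνm : Measurable ν := by
    refine measurable_of_measurable_fourier fun n => ?_
    obtain ⟨n, rfl | rfl⟩ := n.eq_nat_or_neg
    · exact hmom n
    · simp only [integral_fourier_neg]
      exact (Complex.continuous_conj.measurable).comp (hmom n)
  let κ : ProbabilityTheory.Kernel Torus Torus := ⟨ν, hνm⟩
  have hκ : ∀ x, ν x Set.univ ≤ 1 := by
    intro x
    have h0 := hνn x 0
    simp only [Nat.cast_zero, fourier_zero, integral_const, pow_zero] at h0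
    have h1 : Matrix.toEuclideanLin (1 : Matrix (Fin m) (Fin m) ℂ) (u x) = u x := by
      simp
    rw [h1, inner_self_eq_norm_sq_to_K, Complex.real_smul, mul_one] at h0
    have h2 : (ν x).real Set.univ = ‖u x‖ ^ 2 := Complex.ofReal_injective (by rw [h0]; simp)
    have h3 : (ν x).real Set.univ ≤ 1 := by
      rw [h2]; exact pow_le_one₀ (norm_nonneg _) (hu1 x)
    rw [measureReal_def] at h3
    exact (ENNReal.toReal_le_toReal (measure_ne_top _ _) ENNReal.one_ne_top).1 (by simpa using h3)
  have : ProbabilityTheory.IsFiniteKernel κ := ⟨1, ENNReal.one_lt_top, hκ⟩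
  let ρ : Torus → NNReal := fun x => ‖f x‖₊ ^ 2
  have hρm : Measurable ρ := hfm.nnnorm.pow_const 2
  let μ₀ : Measure Torus := volume.withDensity fun x => (ρ x : ℝ≥0∞)
  have : IsFiniteMeasure μ₀ := by
    refine isFiniteMeasure_withDensity ?_
    have := (Lp.memLp f).2
    have h2 := lintegral_rpow_enorm_lt_top_of_eLpNorm_lt_top two_ne_zero ENNReal.ofNat_ne_top this
    simpa [ρ, enorm] using h2.ne
  refine ⟨κ.comp (ProbabilityTheory.Kernel.const Unit μ₀) (), ⟨inferInstance, fun n => ?_⟩,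
    Measure.AbsolutelyContinuous.mk fun A hAm hA0 => ?_⟩
  · have hnat : ∀ n : ℕ, ∫ x, fourier n x ∂(κ.comp (ProbabilityTheory.Kernel.const Unit μ₀) ())
        = ⟪ψ, (U ^ n) ψ⟫_ℂ := by
      intro n
      rw [ProbabilityTheory.Kernel.integral_comp (integrable_continuousMap _ _),
        ProbabilityTheory.Kernel.const_apply, integral_withDensity_eq_integral_smul hρm,
        ← W.inner_map_map, L2.inner_def]
      refine integral_congr_ae ?_
      filter_upwards [coeFn_pow_of_mul hW ψ n] with x hx
      rw [hx]
      change ρ x • ∫ y, fourier n y ∂ν x = ⟪f x, Matrix.toEuclideanLin (T x ^ n) (f x)⟫_ℂ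
      have key : ⟪f x, Matrix.toEuclideanLin (T x ^ n) (f x)⟫_ℂ = ((‖f x‖ ^ 2 : ℝ) : ℂ) *
          ⟪u x, Matrix.toEuclideanLin (T x ^ n) (u x)⟫_ℂ := by
        conv_lhs => rw [← huf x]
        rw [map_smul, inner_smul_left, inner_smul_right, Complex.conj_ofReal]
        push_cast
        ring
      rw [hνn, key, NNReal.smul_def, Complex.real_smul]
      rfl
    obtain ⟨n, rfl | rfl⟩ := n.eq_nat_or_neg
    · exact hnat n
    -- Negative moments are the conjugates of the positive ones, and `⟪U ^ n ψ, ψ⟫ = ⟪ψ, (U ^ n)⁻¹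
    -- ψ⟫` by unitarity.
    · rw [integral_fourier_neg, hnat, inner_conj_symm, zpow_neg, zpow_natCast]
      rw [← (U ^ n).inner_map_map ψ (((U ^ n)⁻¹) ψ)]
      congr 1
      exact ((U ^ n).apply_symm_apply ψ).symm
  · rw [ProbabilityTheory.Kernel.comp_apply' _ _ _ hAm, ProbabilityTheory.Kernel.const_apply,
      lintegral_eq_zero_iff (κ.measurable_coe hAm)]
    refine (withDensity_absolutelyContinuous _ _).ae_le ?_
    filter_upwards [hA A hA0] with x hx
    exact hνA x A hx

/-! ### Off-diagonal entries in the gauge `γ = 0` -/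

theorem scatMatrix_zero_one_ne_zero {r t : ℝ} (ht : 0 < t) (θ α : ℝ) :
    scatMatrix r t θ α 0 0 1 ≠ 0 := by
  simp [scatMatrix, ht.ne']

theorem scatMatrix_one_zero (r t θ α : ℝ) :
    scatMatrix r t θ α 0 1 0 = scatMatrix r t θ α 0 0 1 := by
  simp [scatMatrix]

end Monodromy

end

/-! ### Proof of the theorem -/

open Monodromy in
theorem mainTheorem3 (r t : ℝ) (hr : 0 < r) (ht0 : 0 < t) (ht1 : t < 1)
    (hrt : r ^ 2 + t ^ 2 = 1) (θ α γ : ℤ → ℝ) (N : ℕ) (hN : 1 ≤ N)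
    (hθ : ∀ k : ℤ, θ (k + N) = θ k)
    (hα : ∃ (a : ℝ) (ϖ : ℤ → ℝ), (∀ k : ℤ, ϖ (k + N) = ϖ k) ∧ ∀ k : ℤ, α k = a * k + ϖ k) :
    Monodromy.IsPurelyAC (Monodromy.monodromy r t hrt θ α γ) ∧
    ∃ T : Monodromy.Torus → Matrix (Fin (2 * N)) (Fin (2 * N)) ℂ,
      (∀ x, T x ∈ Matrix.unitaryGroup (Fin (2 * N)) ℂ) ∧
      (∀ i j, AnalyticOnNhd ℝ (fun x : ℝ => T (x : Monodromy.Torus) i j) Set.univ) ∧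
      (∀ c : ℂ, {x : Monodromy.Torus |
        Module.End.HasEigenvalue (Matrix.toLin' (T x)) c}.Finite) ∧
      Monodromy.IsUnitarilyEquivalentToMul (Monodromy.monodromy r t hrt θ α γ) T := by
  obtain ⟨a, ϖ, hϖ, hα⟩ := hα
  obtain rfl : α = fun k : ℤ => a * k + ϖ k := funext hα
  obtain ⟨d, hd⟩ := exists_gauge r t hrt θ γ ϖ a
  have : NeZero (2 * N) := ⟨by omega⟩
  have hm : Even (2 * N) := even_two_mul N
  let S' : ℤ → Matrix.unitaryGroup (Fin 2) ℂ :=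
    fun k => scatUnitary r t hrt (θ k + a / 2) (ϖ k) 0
  let S : ℤ → Matrix (Fin 2) (Fin 2) ℂ := fun k => (S' k).1
  have hper : ∀ k : ℤ, S' (k + (2 * N : ℕ)) = S' k := by
    intro k
    have e : k + ((2 * N : ℕ) : ℤ) = k + N + N := by push_cast; ring
    simp only [S', e, hθ, hϖ]
  have hS : ∀ k : ℤ, S (k + (2 * N : ℕ)) = S k := fun k => congrArg Subtype.val (hper k)
  have hS0 : ∀ k, S k 0 1 ≠ 0 := fun k => scatMatrix_zero_one_ne_zero ht0 _ _
  have hS1 : ∀ k, S k 1 0 = S k 0 1 := fun k => scatMatrix_one_zero _ _ _ _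
  have hU₀ := symbol_mem_unitaryGroup hm 0 hS (fun k => (S' k).2)
  have hU₁ := symbol_mem_unitaryGroup hm 1 hS (fun k => (S' k).2)
  let T : Torus → Matrix (Fin (2 * N)) (Fin (2 * N)) ℂ :=
    fun x => symbol (2 * N) 1 S x * symbol (2 * N) 0 S x
  have hT : Continuous T := (continuous_symbol 1 S).mul (continuous_symbol 0 S)
  have hTU : ∀ x, T x ∈ Matrix.unitaryGroup (Fin (2 * N)) ℂ := fun x => mul_mem (hU₁ x) (hU₀ x)
  have hE : IsUnitarilyEquivalentToMul
      (monodromy r t hrt θ (fun k : ℤ => a * k + ϖ k) γ) T := by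
    -- The unitary equivalence removes the gauge and then applies the Bloch transform of period `2 *
    -- N`.
    refine ⟨(phaseOp d).symm.trans (blochTransform (2 * N)), fun ψ => ?_⟩
    obtain ⟨f, rfl⟩ := (phaseOp d).surjective ψ
    have h1 : ((phaseOp d).symm.trans (blochTransform (2 * N)))
        (monodromy r t hrt θ (fun k : ℤ => a * k + ϖ k) γ (phaseOp d f))
        = mulOp (continuous_symbol 1 S) hU₁
          (mulOp (continuous_symbol 0 S) hU₀ (blochTransform (2 * N) f)) := by
      rw [hd, LinearIsometryEquiv.trans_apply, LinearIsometryEquiv.symm_apply_apply,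
        ← blochTransform_blockOp hm 0 S' hper hU₀, ← blochTransform_blockOp hm 1 S' hper hU₁]
      rfl
    rw [h1, LinearIsometryEquiv.trans_apply, LinearIsometryEquiv.symm_apply_apply]
    filter_upwards [coeFn_mulOp (continuous_symbol 1 S) hU₁
      (mulOp (continuous_symbol 0 S) hU₀ (blochTransform (2 * N) f)),
      coeFn_mulOp (continuous_symbol 0 S) hU₀ (blochTransform (2 * N) f)] with x h2 h3
    rw [h2, h3]
    simp [T, Matrix.toLpLin_apply]
  refine ⟨isPurelyAC_of_mul hT hTU hE fun A hA => ae_not_hasEigenvalue hm hS hS0 hS1 hA, T, hTU,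
    fun i j => ?_, finite_setOf_hasEigenvalue hm hS (fun k => (S' k).2) hS0 hS1, hE⟩
  simp only [T, Matrix.mul_apply]
  exact Finset.analyticOnNhd_fun_sum _ fun l _ =>
    (analyticOnNhd_symbol 1 S i l).mul (analyticOnNhd_symbol 0 S l j)
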